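/- Let $L^2(\mathbb{R}^+)=L^2((0,\infty),dk)$. Define the isometry $\mathcal{R}:L^2(\mathbb{R}^+)\to L^2(\mathbb{R},dx)$ by $(\mathcal{R}\phi)(x)=\frac{1}{\sqrt{2\pi}}\int_0^\infty e^{ixk}\phi(k)\,dk$ (understood in the $L^2$ sense), let $\Pi^-$ be the orthogonal projection of $L^2(\mathbb{R},dx)$ onto the functions supported in $(-\infty,0)$, and for $t\in\mathbb{R}$ let $S_t$ be the unitary operator $(S_t\phi)(k)=e^{-ik^2t}\phi(k)$ on $L^2(\mathbb{R}^+)$. For real $t_1,t_2$ the single backflow operator on $L^2(\mathbb{R}^+)$ is $$B_{\langle t_1,t_2\rangle}=S_{t_2}^*\mathcal{R}^*\Pi^-\mathcal{R}S_{t_2}-S_{t_1}^*\mathcal{R}^*\Pi^-\mathcal{R}S_{t_1},$$ so that, for normalised $\phi$, $\langle\phi, B_{\langle t_1,t_2\rangle}\phi\rangle$ is the difference between the probabilities of finding the free particle (with $\hbar=1$ and mass $\frac12$), whose initial momentum-space state is $\phi$, in $x<0$ at times $t_2$ and $t_1$. **Theorem.** 1. For all $t_1<t_2$, $B_{\langle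 t_1,t_2\rangle}$ is a bounded self-adjoint operator with $\|B_{\langle t_1,t_2\rangle}\|=1$. 2. There is a bounded operator $C$ on $L^2(\mathbb{R}^+)$, independent of $t_1,t_2$, such that for every $\varphi\in L^2(\mathbb{R}^+)$ and almost every $p>0$ $$(C\varphi)(p)=-\frac{1}{2\pi}\int_0^\infty \frac{\sin(p-q)}{p-q}\left[\left(\frac{p}{q}\right)^{1/4}+\left(\frac{p}{q}\right)^{-1/4}\right]\varphi(q)\,dq,$$ where the integral converges absolutely, and for all $t_1<t_2$ the operator $B_{\langle t_1,t_2\rangle}$ is unitarily equivalent to $C$: there is a unitary $U$ on $L^2(\mathbb{R}^+)$ with $U B_{\langle t_1,t_2\rangle}U^*=C$. 3. The map $(t_1,t_2)\mapsto B_{\langle t_1,t_2\rangle}$ is strongly continuous on $\{(t_1,t_2)\in\mathbb{R}^2 : t_1<t_2\}$, i.e. $(t_1,t_2)\mapsto B_{\langle t_1,t_2\rangle}\phi$ is norm continuous there for every $\phi\in L^2(\mathbb{R}^+)$. -/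

import Mathlib

open MeasureTheory Set Filter
open scoped ENNReal InnerProductSpace FourierTransform

namespace Backflow

noncomputable section

/-- The Hilbert space `L²(ℝ, dx)` of complex wavefunctions on the line. -/
abbrev L2Line : Type := Lp ℂ 2 (volume : Measure ℝ)

/-- The Hilbert space `L²(ℝ⁺, dk)`, for Lebesgue measure on `(0, ∞)`. -/
abbrev L2Half : Type := Lp ℂ 2 (volume.restrict (Ioi (0 : ℝ)))

theorem memLp_action {μ ν : Measure ℝ} (T : (ℝ → ℂ) →ₗ[ℂ] (ℝ → ℂ))
    (hmeas : ∀ f : ℝ → ℂ, AEStronglyMeasurable f μ → AEStronglyMeasurable (T f) ν)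
    (hnorm : ∀ f : ℝ → ℂ, AEStronglyMeasurable f μ → eLpNorm (T f) 2 ν ≤ eLpNorm f 2 μ)
    (f : Lp ℂ 2 μ) : MemLp (T f) 2 ν :=
  ⟨hmeas f (Lp.aestronglyMeasurable f),
    (hnorm f (Lp.aestronglyMeasurable f)).trans_lt (Lp.memLp f).2⟩

/-- The operator between `L²` spaces given by a linear action `T` on functions, when `T` respects
almost everywhere equality and does not increase the `L²` norm. -/
def ofAction {μ ν : Measure ℝ} (T : (ℝ → ℂ) →ₗ[ℂ] (ℝ → ℂ))
    (hcongr : ∀ f g : ℝ → ℂ, f =ᵐ[μ] g → T f =ᵐ[ν] T g)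
    (hmeas : ∀ f : ℝ → ℂ, AEStronglyMeasurable f μ → AEStronglyMeasurable (T f) ν)
    (hnorm : ∀ f : ℝ → ℂ, AEStronglyMeasurable f μ → eLpNorm (T f) 2 ν ≤ eLpNorm f 2 μ) :
    Lp ℂ 2 μ →L[ℂ] Lp ℂ 2 ν :=
  LinearMap.mkContinuous
    { toFun := fun f => (memLp_action T hmeas hnorm f).toLp (T f)
      map_add' := fun f g => by
        rw [← MemLp.toLp_add (memLp_action T hmeas hnorm f) (memLp_action T hmeas hnorm g),
          MemLp.toLp_eq_toLp_iff, ← map_add]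
        exact hcongr _ _ (Lp.coeFn_add f g)
      map_smul' := fun c f => by
        rw [RingHom.id_apply, ← MemLp.toLp_const_smul c (memLp_action T hmeas hnorm f),
          MemLp.toLp_eq_toLp_iff,
          ← map_smul]
        exact hcongr _ _ (Lp.coeFn_smul c f) }
    1 fun f => by
      rw [one_mul]
      change ‖(memLp_action T hmeas hnorm f).toLp (T f)‖ ≤ ‖f‖
      rw [Lp.norm_toLp, Lp.norm_def]
      exact ENNReal.toReal_mono (Lp.memLp f).2.ne (hnorm f (Lp.aestronglyMeasurable f))

theorem coeFn_ofAction {μ ν : Measure ℝ} (T : (ℝ → ℂ) →ₗ[ℂ] (ℝ → ℂ))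
    (hcongr : ∀ f g : ℝ → ℂ, f =ᵐ[μ] g → T f =ᵐ[ν] T g)
    (hmeas : ∀ f : ℝ → ℂ, AEStronglyMeasurable f μ → AEStronglyMeasurable (T f) ν)
    (hnorm : ∀ f : ℝ → ℂ, AEStronglyMeasurable f μ → eLpNorm (T f) 2 ν ≤ eLpNorm f 2 μ)
    (f : Lp ℂ 2 μ) : ofAction T hcongr hmeas hnorm f =ᵐ[ν] T f :=
  MemLp.coeFn_toLp (memLp_action T hmeas hnorm f)

/-- Multiplication by a measurable function `m` with `|m| ≤ 1`. -/
def mulOp (μ : Measure ℝ) (m : ℝ → ℂ) (hm : Measurable m) (hb : ∀ x, ‖m x‖ ≤ 1) :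
    Lp ℂ 2 μ →L[ℂ] Lp ℂ 2 μ :=
  ofAction
    { toFun := fun f x => m x * f x
      map_add' := fun f g => by ext x; simp [mul_add]
      map_smul' := fun c f => by ext x; simp [mul_left_comm] }
    (fun f g h => by filter_upwards [h] with x hx; simp [hx])
    (fun f hf => hm.aestronglyMeasurable.mul hf)
    (fun f _ => eLpNorm_mono fun x => by
      simpa using mul_le_mul_of_nonneg_right (hb x) (norm_nonneg (f x)))

theorem coeFn_mulOp (μ : Measure ℝ) (m : ℝ → ℂ) (hm : Measurable m) (hb : ∀ x, ‖m x‖ ≤ 1)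
    (f : Lp ℂ 2 μ) : mulOp μ m hm hb f =ᵐ[μ] fun x => m x * f x :=
  coeFn_ofAction _ _ _ _ f

/-- The inclusion `L²(ℝ⁺) → L²(ℝ)`: extension by zero. -/
def extendZero : L2Half →L[ℂ] L2Line :=
  ofAction
    { toFun := fun f => (Ioi (0 : ℝ)).indicator f
      map_add' := fun f g => indicator_add _ f g
      map_smul' := fun c f => indicator_const_smul _ c f }
    (fun _ _ h => by
      filter_upwards [(ae_restrict_iff' measurableSet_Ioi).1 h] with x hx
      by_cases hmem : x ∈ Ioi (0 : ℝ)
      · simp only [LinearMap.coe_mk, AddHom.coe_mk, indicator_of_mem hmem, hx hmem]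
      · simp only [LinearMap.coe_mk, AddHom.coe_mk, indicator_of_notMem hmem])
    (fun _ hf => (aestronglyMeasurable_indicator_iff measurableSet_Ioi).2 hf)
    (fun _ _ => (eLpNorm_indicator_eq_eLpNorm_restrict measurableSet_Ioi).le)

theorem coeFn_extendZero (φ : L2Half) :
    extendZero φ =ᵐ[volume] (Ioi (0 : ℝ)).indicator φ :=
  coeFn_ofAction _ _ _ _ φ

theorem map_scale : (volume : Measure ℝ).map (fun x => (2 * Real.pi)⁻¹ * x) =
    ENNReal.ofReal (2 * Real.pi) • (volume : Measure ℝ) := by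
  have h : (0 : ℝ) < 2 * Real.pi := by positivity
  rw [Real.map_volume_mul_left (inv_ne_zero h.ne'), inv_inv, abs_of_pos h]

theorem quasiMeasurePreserving_scale :
    Measure.QuasiMeasurePreserving (fun x : ℝ => (2 * Real.pi)⁻¹ * x) volume volume :=
  ⟨by fun_prop, by rw [map_scale]; exact Measure.smul_absolutelyContinuous⟩

theorem eLpNorm_scale (f : ℝ → ℂ) (hf : AEStronglyMeasurable f volume) :
    eLpNorm (fun x => ((1 / √(2 * Real.pi) : ℝ) : ℂ) * f ((2 * Real.pi)⁻¹ * x)) 2 volume =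
      eLpNorm f 2 volume := by
  have h : (0 : ℝ) < 2 * Real.pi := by positivity
  have h1 : eLpNorm (fun x => f ((2 * Real.pi)⁻¹ * x)) 2 volume =
      ENNReal.ofReal (√(2 * Real.pi)) * eLpNorm f 2 volume := by
    have hf' : AEStronglyMeasurable f
        ((volume : Measure ℝ).map (fun x => (2 * Real.pi)⁻¹ * x)) := by
      rw [map_scale]; exact hf.smul_measure _
    have := eLpNorm_map_measure (p := 2) hf' (by fun_prop)
    rw [map_scale, eLpNorm_smul_measure_of_ne_top (by norm_num)] at this
    rw [show (fun x => f ((2 * Real.pi)⁻¹ * x)) = f ∘ fun x => (2 * Real.pi)⁻¹ * x from rfl,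
      ← this, smul_eq_mul, Real.sqrt_eq_rpow, ← ENNReal.ofReal_rpow_of_pos h]
    norm_num
  have h2 := eLpNorm_const_smul ((1 / √(2 * Real.pi) : ℝ) : ℂ)
    (fun x => f ((2 * Real.pi)⁻¹ * x)) 2 (volume : Measure ℝ)
  have h3 : ‖((1 / √(2 * Real.pi) : ℝ) : ℂ)‖ₑ = ENNReal.ofReal (1 / √(2 * Real.pi)) := by
    rw [← ofReal_norm, Complex.norm_real, Real.norm_of_nonneg (by positivity)]
  change eLpNorm (((1 / √(2 * Real.pi) : ℝ) : ℂ) • fun x => f ((2 * Real.pi)⁻¹ * x)) 2 volume = _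
  rw [h2, h3, h1, ← mul_assoc, ← ENNReal.ofReal_mul (by positivity),
    one_div_mul_cancel (Real.sqrt_pos.2 h).ne', ENNReal.ofReal_one, one_mul]

/-- The unitary dilation `f ↦ (2π)^{-1/2} f(x / 2π)` of `L²(ℝ)`. -/
def dilation : L2Line →L[ℂ] L2Line :=
  ofAction
    { toFun := fun f x => ((1 / √(2 * Real.pi) : ℝ) : ℂ) * f ((2 * Real.pi)⁻¹ * x)
      map_add' := fun f g => by ext x; simp [mul_add]
      map_smul' := fun c f => by ext x; simp [mul_left_comm] }
    (fun f g h => by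
      filter_upwards [quasiMeasurePreserving_scale.ae_eq_comp h] with x hx
      exact congrArg (fun z => ((1 / √(2 * Real.pi) : ℝ) : ℂ) * z) hx)
    (fun f hf => by
      have := hf.comp_quasiMeasurePreserving quasiMeasurePreserving_scale
      exact this.const_mul _)
    (fun f hf => (eLpNorm_scale f hf).le)

theorem coeFn_dilation (f : L2Line) :
    dilation f =ᵐ[volume] fun x => ((1 / √(2 * Real.pi) : ℝ) : ℂ) * f ((2 * Real.pi)⁻¹ * x) :=
  coeFn_ofAction _ _ _ _ f

/-- The reverse Fourier transform `(ℛ φ)(x) = (2π)^{-1/2} ∫₀^∞ e^{ixk} φ(k) dk` from `L²(ℝ⁺, dk)` to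
`L²(ℝ, dx)`. Mathlib's `𝓕⁻` on `L²(ℝ)` has kernel `e^{2πixk}`, hence the dilation. -/
def reverseFourier : L2Half →L[ℂ] L2Line :=
  dilation ∘L (Lp.fourierTransformₗᵢ ℝ ℂ).symm.toContinuousLinearEquiv.toContinuousLinearMap ∘L
    extendZero

/-- Free time evolution in momentum space, `(S_t φ)(k) = e^{-ik²t} φ(k)`. -/
def freeEvolution (t : ℝ) : L2Half →L[ℂ] L2Half :=
  mulOp _ (fun k => Complex.exp (((-(k ^ 2 * t) : ℝ) : ℂ) * Complex.I))
    (by fun_prop) (fun _ => (Complex.norm_exp_ofReal_mul_I _).le)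

/-- The projection `Π⁻` of `L²(ℝ)` onto the functions supported on the negative half-line. -/
def negProj : L2Line →L[ℂ] L2Line :=
  mulOp _ ((Iio (0 : ℝ)).indicator 1) (measurable_one.indicator measurableSet_Iio)
    (fun x => by by_cases h : x ∈ Iio (0 : ℝ) <;> simp [h])

/-- `S_t^* ℛ^* Π⁻ ℛ S_t`: its quadratic form at a normalised `φ` is the probability of finding the
particle with initial momentum-space state `φ` in `x < 0` at time `t`. -/
def leftProbOp (t : ℝ) : L2Half →L[ℂ] L2Half :=
  (freeEvolution t).adjoint ∘L reverseFourier.adjoint ∘L negProj ∘L reverseFourier ∘L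
    freeEvolution t

/-- The single backflow operator
`B_{⟨t₁,t₂⟩} = S_{t₂}^* ℛ^* Π⁻ ℛ S_{t₂} - S_{t₁}^* ℛ^* Π⁻ ℛ S_{t₁}` on `L²(ℝ⁺)`. -/
def backflowOp (t₁ t₂ : ℝ) : L2Half →L[ℂ] L2Half :=
  leftProbOp t₂ - leftProbOp t₁

/-- The probability `∫_{x<0} |ψ_t(x)|² dx` of finding the particle in `x < 0` at time `t`, where
`ψ_t = e^{-iHt} ℛ φ = ℛ S_t φ`. -/
def leftProb (φ : L2Half) (t : ℝ) : ℝ :=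
  ∫ x in Iio (0 : ℝ), ‖reverseFourier (freeEvolution t φ) x‖ ^ 2

theorem inner_leftProbOp (t : ℝ) (φ : L2Half) :
    ⟪φ, leftProbOp t φ⟫_ℂ = (leftProb φ t : ℂ) := by
  have h : leftProbOp t φ = (freeEvolution t).adjoint (reverseFourier.adjoint
      (negProj (reverseFourier (freeEvolution t φ)))) := rfl
  rw [h, ContinuousLinearMap.adjoint_inner_right, ContinuousLinearMap.adjoint_inner_right,
    leftProb, ← integral_indicator measurableSet_Iio, L2.inner_def, ← integral_complex_ofReal]
  refine integral_congr_ae ?_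
  have hc := coeFn_mulOp volume ((Iio (0 : ℝ)).indicator 1)
    (measurable_one.indicator measurableSet_Iio)
    (fun x => by by_cases h : x ∈ Iio (0 : ℝ) <;> simp [h])
    (reverseFourier (freeEvolution t φ))
  filter_upwards [hc] with x hx
  rw [negProj, hx]
  by_cases hmem : x ∈ Iio (0 : ℝ)
  · rw [indicator_of_mem hmem, indicator_of_mem hmem, Pi.one_apply, one_mul,
      inner_self_eq_norm_sq_to_K]
    simp
  · simp [indicator_of_notMem hmem]

/-- The quadratic form of the backflow operator is the probability backflow from `t₁` to `t₂`. -/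
theorem inner_backflowOp (t₁ t₂ : ℝ) (φ : L2Half) :
    ⟪φ, backflowOp t₁ t₂ φ⟫_ℂ = ((leftProb φ t₂ - leftProb φ t₁ : ℝ) : ℂ) := by
  rw [backflowOp, sub_apply, inner_sub_right, inner_leftProbOp,
    inner_leftProbOp, Complex.ofReal_sub]

/-- The real kernel
`-(1/2π) · sin(p-q)/(p-q) · [(p/q)^{1/4} + (p/q)^{-1/4}]`, used for `p, q > 0`. (The value on the
diagonal is irrelevant to integrals over `q`.) -/
def kernelC (p q : ℝ) : ℝ :=
  -(1 / (2 * Real.pi)) * (Real.sin (p - q) / (p - q)) *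
    ((p / q) ^ (1 / 4 : ℝ) + (p / q) ^ (-(1 / 4) : ℝ))

/-- `C` acts as the integral operator on `L²(ℝ⁺)` with kernel `K`: for every `φ` and almost every
`p > 0` the integral `∫₀^∞ K(p,q) φ(q) dq` converges absolutely and equals `(C φ)(p)`. -/
def HasKernel (C : L2Half →L[ℂ] L2Half) (K : ℝ → ℝ → ℝ) : Prop :=
  ∀ φ : L2Half, ∀ᵐ p ∂(volume.restrict (Ioi (0 : ℝ))),
    IntegrableOn (fun q => (K p q : ℂ) * φ q) (Ioi 0) ∧
      C φ p = ∫ q in Ioi (0 : ℝ), (K p q : ℂ) * φ q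

/-- Unitary equivalence of bounded operators on `L²(ℝ⁺)`: `U A U⁻¹ = A'` for some unitary `U`. -/
def UnitarilyEquivalent (A A' : L2Half →L[ℂ] L2Half) : Prop :=
  ∃ U : L2Half ≃ₗᵢ[ℂ] L2Half, ∀ φ : L2Half, U (A (U.symm φ)) = A' φ

end

end Backflow

namespace Backflow

open Topology SchwartzMap

local notation "μ₊" => Measure.restrict (volume : Measure ℝ) (Ioi (0 : ℝ))

/-! Kernel. Damp the position integral over x < 0 by e^{εx}. Integrating out x gives the quadratic
form of `leftProbOp t` as the limit ε → 0⁺ of forms with kernel e^{it(p²-q²)} / (2π(ε + i(q-p))).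
Each limit is singular on p = q, but the singularity does not depend on t. In the difference of two
times it cancels, and `backflowOp` is the integral operator with kernel `backflowKernel`
(`coeFn_backflowOp`).

Equivalence. Let m be the midpoint and T the half-length of the time interval. Conjugation by
e^{imp²} turns the difference of exponentials into 2i sin(T(p²-q²)), and the scaled energy u = Tp²
absorbs T. The kernel becomes `kernelC`, free of m and T (`hasKernel_energyBackflowOp`). A kernel
determines its operator (`HasKernel.unique`), so one C serves all time intervals.

Norm. Since 2Π⁻ - 1 is a reflection, 2 `leftProbOp t` - 1 is a contraction, and 2B is a difference
of two contractions, so ‖B‖ ≤ 1. For the converse, unitary equivalence makes the norm the same for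
all intervals, so (-1, 1) suffices. There a momentum boost by n moves the state by 2nt: far left at
t = -1 and far right at t = 1. The expectation of B tends to -1.

Strong continuity. It is inherited from that of the unitary group S_t, by dominated convergence. -/

/-! ### The inverse Fourier transform on L¹ ∩ L² -/

theorem integral_fourierInv_mul_eq_of_integrable {f g : ℝ → ℂ} (hf : Integrable f)
    (hg : Integrable g) : ∫ x, 𝓕⁻ g x * f x = ∫ x, g x * 𝓕⁻ f x := by
  have hflip : (-innerₗ ℝ : ℝ →ₗ[ℝ] ℝ →ₗ[ℝ] ℝ).flip = -innerₗ ℝ := by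
    ext; simp
  have := VectorFourier.integral_fourierIntegral_smul_eq_flip (e := Real.fourierChar)
    (L := (-innerₗ ℝ : ℝ →ₗ[ℝ] ℝ →ₗ[ℝ] ℝ)) Real.continuous_fourierChar
    (by simp only [LinearMap.neg_apply, innerₗ_apply_apply]; fun_prop) hg hf
  rw [hflip] at this
  exact this

theorem continuous_fourierInv_of_integrable {f : ℝ → ℂ} (hf : Integrable f) :
    Continuous (𝓕⁻ f) :=
  VectorFourier.fourierIntegral_continuous (e := Real.fourierChar)
    (L := (-innerₗ ℝ : ℝ →ₗ[ℝ] ℝ →ₗ[ℝ] ℝ)) Real.continuous_fourierChar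
    (by simp only [LinearMap.neg_apply, innerₗ_apply_apply]; fun_prop) hf

/-- The inverse Fourier transform on `L²` is given by the Fourier integral on `L¹ ∩ L²`. -/
theorem coeFn_fourierInv_of_integrable (f : L2Line) (hf : Integrable f) :
    ((𝓕⁻ f : L2Line) : ℝ → ℂ) =ᵐ[volume] 𝓕⁻ (f : ℝ → ℂ) := by
  refine ae_eq_of_integral_contDiff_smul_eq
    ((Lp.memLp (𝓕⁻ f : L2Line)).locallyIntegrable (by norm_num))
    (continuous_fourierInv_of_integrable hf).locallyIntegrable fun g hg hgc => ?_
  have hgc' : HasCompactSupport fun x => (g x : ℂ) := hgc.comp_left (g := Complex.ofReal) (by simp)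
  have hg' : ContDiff ℝ ((⊤ : ℕ∞) : WithTop ℕ∞) fun x => (g x : ℂ) :=
    Complex.ofRealCLM.contDiff.comp hg
  set G : 𝓢(ℝ, ℂ) := hgc'.toSchwartzMap hg' with hG
  have hGx : ∀ x, G x = (g x : ℂ) := fun x => rfl
  -- The `L²` transform agrees with the distributional one, so it can be moved onto the test
  -- function. Fubini then moves it back onto `f` as a Fourier integral.
  have h1 : Lp.toTemperedDistribution (𝓕⁻ f : L2Line) G =
      Lp.toTemperedDistribution f (𝓕⁻ G) := by
    rw [← Lp.fourierInv_toTemperedDistribution_eq, TemperedDistribution.fourierInv_apply]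
  rw [Lp.toTemperedDistribution_apply, Lp.toTemperedDistribution_apply] at h1
  simp only [smul_eq_mul, hGx, SchwartzMap.fourierInv_coe] at h1
  simp only [Complex.real_smul]
  rw [h1, integral_fourierInv_mul_eq_of_integrable hf G.integrable]
  simp only [hGx]

/-! ### Multiplication operators and free evolution -/

/-- Dominated convergence for |(m i - m') φ|², with majorant 4|φ|² because both multipliers are
bounded by 1. -/
theorem tendsto_mulOp {ι : Type*} {l : Filter ι} [l.IsCountablyGenerated] {μ : Measure ℝ}
    {m : ι → ℝ → ℂ} {m' : ℝ → ℂ} (hm : ∀ i, Measurable (m i)) (hb : ∀ i x, ‖m i x‖ ≤ 1)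
    (hm' : Measurable m') (hb' : ∀ x, ‖m' x‖ ≤ 1)
    (h : ∀ x, Tendsto (fun i => m i x) l (𝓝 (m' x))) (φ : Lp ℂ 2 μ) :
    Tendsto (fun i => mulOp μ (m i) (hm i) (hb i) φ) l (𝓝 (mulOp μ m' hm' hb' φ)) := by
  rw [Lp.tendsto_Lp_iff_tendsto_eLpNorm']
  have hN : ∀ i, eLpNorm (⇑(mulOp μ (m i) (hm i) (hb i) φ) - ⇑(mulOp μ m' hm' hb' φ)) 2 μ =
      (∫⁻ x, ‖(m i x - m' x) * φ x‖ₑ ^ (2 : ℝ) ∂μ) ^ (1 / 2 : ℝ) := fun i => by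
    rw [eLpNorm_eq_lintegral_rpow_enorm_toReal (by norm_num) (by norm_num)]
    simp only [ENNReal.toReal_ofNat]
    congr 1
    refine lintegral_congr_ae ?_
    filter_upwards [coeFn_mulOp μ (m i) (hm i) (hb i) φ, coeFn_mulOp μ m' hm' hb' φ] with x h1 h2
    rw [Pi.sub_apply, h1, h2, sub_mul]
  simp_rw [hN]
  have h0 : Tendsto (fun i => ∫⁻ x, ‖(m i x - m' x) * φ x‖ₑ ^ (2 : ℝ) ∂μ) l (𝓝 0) := by
    have hφ := (eLpNorm_lt_top_iff_lintegral_rpow_enorm_lt_top (p := 2) (by norm_num)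
      (by norm_num)).1 (Lp.memLp φ).2
    rw [ENNReal.toReal_ofNat] at hφ
    have := tendsto_lintegral_filter_of_dominated_convergence (μ := μ) (l := l)
      (F := fun i x => ‖(m i x - m' x) * φ x‖ₑ ^ (2 : ℝ)) (f := fun _ => 0)
      (fun x => 4 * ‖φ x‖ₑ ^ (2 : ℝ)) ?_ ?_ ?_ ?_
    · simpa using this
    · exact .of_forall fun i =>
        (((hm i).sub hm').mul (Lp.stronglyMeasurable φ).measurable).enorm.pow_const _
    · refine .of_forall fun i => .of_forall fun x => ?_
      rw [enorm_mul, ENNReal.mul_rpow_of_nonneg _ _ (by norm_num)]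
      gcongr
      have h2 : ‖m i x - m' x‖ₑ ≤ 2 := by
        rw [← ofReal_norm, ← ENNReal.ofReal_ofNat 2]
        exact ENNReal.ofReal_le_ofReal ((norm_sub_le _ _).trans (by linarith [hb i x, hb' x]))
      refine (ENNReal.rpow_le_rpow h2 (by norm_num)).trans (le_of_eq ?_)
      rw [ENNReal.rpow_ofNat]; norm_num
    · rw [lintegral_const_mul' _ _ (by norm_num)]
      exact (ENNReal.mul_lt_top (by norm_num) hφ).ne
    · refine .of_forall fun x => ?_
      have h1 : Tendsto (fun i => (m i x - m' x) * φ x) l (𝓝 0) := by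
        simpa using ((h x).sub_const (m' x)).mul_const (φ x)
      simpa using h1.enorm.ennrpow_const (2 : ℝ)
  simpa using h0.ennrpow_const (1 / 2 : ℝ)

theorem inner_eq_integral {μ : Measure ℝ} (f g : Lp ℂ 2 μ) :
    ⟪f, g⟫_ℂ = ∫ x, starRingEnd ℂ (f x) * g x ∂μ := by
  rw [L2.inner_def]
  refine integral_congr_ae (.of_forall fun x => ?_)
  simp only [RCLike.inner_apply]
  rw [mul_comm]

theorem adjoint_mulOp {μ : Measure ℝ} {m : ℝ → ℂ} (hm : Measurable m) (hb : ∀ x, ‖m x‖ ≤ 1)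
    {m' : ℝ → ℂ} (hm' : Measurable m') (hb' : ∀ x, ‖m' x‖ ≤ 1)
    (h : ∀ x, m' x = starRingEnd ℂ (m x)) :
    (mulOp μ m hm hb).adjoint = mulOp μ m' hm' hb' := by
  refine ((ContinuousLinearMap.eq_adjoint_iff _ _).2 fun f g => ?_).symm
  rw [inner_eq_integral, inner_eq_integral]
  refine integral_congr_ae ?_
  filter_upwards [coeFn_mulOp μ m hm hb g, coeFn_mulOp μ m' hm' hb' f] with x h1 h2
  rw [h1, h2, h x, map_mul, Complex.conj_conj]
  ring

theorem norm_eq_of_norm_coeFn_ae_eq {μ : Measure ℝ} {f g : Lp ℂ 2 μ}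
    (h : ∀ᵐ x ∂μ, ‖f x‖ = ‖g x‖) : ‖f‖ = ‖g‖ := by
  rw [Lp.norm_def, Lp.norm_def, eLpNorm_congr_norm_ae h]

theorem norm_mulOp_apply {μ : Measure ℝ} {m : ℝ → ℂ} (hm : Measurable m)
    (h1 : ∀ x, ‖m x‖ = 1) (f : Lp ℂ 2 μ) : ‖mulOp μ m hm (fun x => (h1 x).le) f‖ = ‖f‖ := by
  refine norm_eq_of_norm_coeFn_ae_eq ?_
  filter_upwards [coeFn_mulOp μ m hm (fun x => (h1 x).le) f] with x hx
  rw [hx, norm_mul, h1, one_mul]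

theorem coeFn_freeEvolution (t : ℝ) (φ : L2Half) :
    freeEvolution t φ =ᵐ[volume.restrict (Ioi 0)]
      fun k => Complex.exp (((-(k ^ 2 * t) : ℝ) : ℂ) * Complex.I) * φ k :=
  coeFn_mulOp _ _ _ _ φ

theorem norm_freeEvolution (t : ℝ) (φ : L2Half) : ‖freeEvolution t φ‖ = ‖φ‖ :=
  norm_mulOp_apply _ (fun _ => Complex.norm_exp_ofReal_mul_I _) φ

theorem adjoint_freeEvolution (t : ℝ) : (freeEvolution t).adjoint = freeEvolution (-t) := by
  refine adjoint_mulOp _ _ _ _ fun k => ?_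
  rw [← Complex.exp_conj]
  simp

theorem continuous_freeEvolution (φ : L2Half) : Continuous fun t => freeEvolution t φ := by
  refine continuous_iff_continuousAt.2 fun t => ?_
  refine tendsto_mulOp _ _ _ _ (fun k => ?_) φ
  have : Continuous fun t : ℝ => Complex.exp (((-(k ^ 2 * t) : ℝ) : ℂ) * Complex.I) := by fun_prop
  exact this.tendsto t

/-! ### The isometry from momentum to position space -/

theorem norm_extendZero (φ : L2Half) : ‖extendZero φ‖ = ‖φ‖ := by
  rw [Lp.norm_def, Lp.norm_def, eLpNorm_congr_ae (coeFn_extendZero φ),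
    eLpNorm_indicator_eq_eLpNorm_restrict measurableSet_Ioi]

theorem norm_dilation (f : L2Line) : ‖dilation f‖ = ‖f‖ := by
  rw [Lp.norm_def, Lp.norm_def, eLpNorm_congr_ae (coeFn_dilation f),
    eLpNorm_scale _ (Lp.aestronglyMeasurable f)]

theorem norm_reverseFourier (φ : L2Half) : ‖reverseFourier φ‖ = ‖φ‖ := by
  have : reverseFourier φ = dilation ((Lp.fourierTransformₗᵢ ℝ ℂ).symm (extendZero φ)) := rfl
  rw [this, norm_dilation, LinearIsometryEquiv.norm_map, norm_extendZero]

/-- The Fourier integral `(2π)^{-1/2} ∫₀^∞ e^{ixk} f(k) dk`. -/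
noncomputable def fourierHalf (f : ℝ → ℂ) (x : ℝ) : ℂ :=
  ((1 / √(2 * Real.pi) : ℝ) : ℂ) *
    ∫ k in Ioi (0 : ℝ), Complex.exp (((x * k : ℝ) : ℂ) * Complex.I) * f k

theorem coeFn_reverseFourier {φ : L2Half} (hφ : IntegrableOn φ (Ioi 0)) :
    reverseFourier φ =ᵐ[volume] fourierHalf φ := by
  have hF : Integrable (extendZero φ) :=
    (integrable_indicator_iff measurableSet_Ioi |>.2 hφ).congr (coeFn_extendZero φ).symm
  have hR : reverseFourier φ = dilation (𝓕⁻ (extendZero φ)) := rfl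
  rw [hR]
  filter_upwards [coeFn_dilation (𝓕⁻ (extendZero φ)),
    quasiMeasurePreserving_scale.ae_eq_comp (coeFn_fourierInv_of_integrable _ hF)] with x h1 h2
  simp only [Function.comp_apply] at h2
  rw [h1, h2, fourierHalf, Real.fourierInv_eq', ← integral_indicator measurableSet_Ioi]
  congr 1
  refine integral_congr_ae ?_
  filter_upwards [coeFn_extendZero φ] with k hk
  rw [hk]
  by_cases hmem : k ∈ Ioi (0 : ℝ)
  · rw [indicator_of_mem hmem, indicator_of_mem hmem, smul_eq_mul]
    congr 4
    simp only [RCLike.inner_apply, conj_trivial]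
    field_simp
  · rw [indicator_of_notMem hmem, indicator_of_notMem hmem, smul_zero]

/-- The map `ℛ S_t` from initial momentum-space states to position-space states at time `t`. -/
noncomputable def positionState (t : ℝ) : L2Half →L[ℂ] L2Line :=
  reverseFourier ∘L freeEvolution t

theorem leftProbOp_eq (t : ℝ) :
    leftProbOp t = (positionState t).adjoint ∘L negProj ∘L positionState t := by
  rw [positionState, ContinuousLinearMap.adjoint_comp]
  rfl

theorem norm_positionState (t : ℝ) (φ : L2Half) : ‖positionState t φ‖ = ‖φ‖ :=
  (norm_reverseFourier _).trans (norm_freeEvolution t φ)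

theorem inner_leftProbOp_right (t : ℝ) (f φ : L2Half) :
    ⟪f, leftProbOp t φ⟫_ℂ = ⟪positionState t f, negProj (positionState t φ)⟫_ℂ := by
  have h : leftProbOp t φ = (positionState t).adjoint (negProj (positionState t φ)) := by
    rw [leftProbOp_eq]
    rfl
  rw [h, ContinuousLinearMap.adjoint_inner_right]

/-! ### Self-adjointness and the upper bound for the norm -/

theorem isSelfAdjoint_negProj : IsSelfAdjoint negProj := by
  rw [ContinuousLinearMap.isSelfAdjoint_iff']
  refine adjoint_mulOp _ _ _ _ fun x => ?_
  by_cases h : x ∈ Iio (0 : ℝ) <;> simp [h]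

theorem coeFn_negProj (f : L2Line) :
    negProj f =ᵐ[volume] (Iio (0 : ℝ)).indicator f := by
  filter_upwards [coeFn_mulOp volume ((Iio (0 : ℝ)).indicator 1)
    (measurable_one.indicator measurableSet_Iio)
    (fun x => by by_cases h : x ∈ Iio (0 : ℝ) <;> simp [h]) f] with x hx
  rw [negProj, hx]
  by_cases h : x ∈ Iio (0 : ℝ)
  · rw [indicator_of_mem h, indicator_of_mem h, Pi.one_apply, one_mul]
  · rw [indicator_of_notMem h, indicator_of_notMem h, zero_mul]

theorem isSelfAdjoint_backflowOp (t₁ t₂ : ℝ) : IsSelfAdjoint (backflowOp t₁ t₂) := by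
  have h (t : ℝ) : IsSelfAdjoint (leftProbOp t) := by
    rw [leftProbOp_eq]
    exact isSelfAdjoint_negProj.adjoint_conj _
  exact (h t₂).sub (h t₁)

/-- The operator 2Π⁻ - 1 multiplies by 1 on x < 0 and by -1 elsewhere. -/
theorem norm_two_negProj_sub (f : L2Line) : ‖(2 : ℂ) • negProj f - f‖ = ‖f‖ := by
  refine norm_eq_of_norm_coeFn_ae_eq ?_
  filter_upwards [Lp.coeFn_sub ((2 : ℂ) • negProj f) f, Lp.coeFn_smul (2 : ℂ) (negProj f),
    coeFn_negProj f] with x h1 h2 h3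
  rw [h1, Pi.sub_apply, h2, Pi.smul_apply, h3]
  by_cases h : x ∈ Iio (0 : ℝ)
  · rw [indicator_of_mem h, two_smul, add_sub_cancel_right]
  · rw [indicator_of_notMem h, smul_zero, zero_sub, norm_neg]

/-- With V = `positionState t` and V*V = 1, the operator on the left is V*(2Π⁻ - 1)V, the
compression of a reflection. -/
theorem norm_two_leftProbOp_sub_le (t : ℝ) (φ : L2Half) :
    ‖(2 : ℂ) • leftProbOp t φ - φ‖ ≤ ‖φ‖ := by
  have h1 : (positionState t).adjoint (positionState t φ) = φ :=
    congrArg (fun A : L2Half →L[ℂ] L2Half => A φ)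
      ((ContinuousLinearMap.norm_map_iff_adjoint_comp_self _).1 (norm_positionState t))
  have h2 : ‖(positionState t).adjoint‖ ≤ 1 := by
    rw [LinearIsometryEquiv.norm_map]
    exact ContinuousLinearMap.opNorm_le_bound _ zero_le_one fun f => by
      rw [norm_positionState, one_mul]
  have h3 : (2 : ℂ) • leftProbOp t φ - φ =
      (positionState t).adjoint
        ((2 : ℂ) • negProj (positionState t φ) - positionState t φ) := by
    rw [map_sub, map_smul, h1, leftProbOp_eq]
    rfl
  rw [h3]
  refine ((positionState t).adjoint.le_of_opNorm_le h2 _).trans ?_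
  rw [one_mul, norm_two_negProj_sub, norm_positionState]

theorem norm_backflowOp_le (t₁ t₂ : ℝ) : ‖backflowOp t₁ t₂‖ ≤ 1 := by
  refine ContinuousLinearMap.opNorm_le_bound _ zero_le_one fun φ => ?_
  have h : (2 : ℂ) • backflowOp t₁ t₂ φ =
      ((2 : ℂ) • leftProbOp t₂ φ - φ) - ((2 : ℂ) • leftProbOp t₁ φ - φ) := by
    rw [sub_sub_sub_cancel_right, ← smul_sub]
    rfl
  have h2 := norm_sub_le ((2 : ℂ) • leftProbOp t₂ φ - φ) ((2 : ℂ) • leftProbOp t₁ φ - φ)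
  rw [← h, norm_smul, Complex.norm_ofNat] at h2
  linarith [norm_two_leftProbOp_sub_le t₁ φ, norm_two_leftProbOp_sub_le t₂ φ]

/-! ### Strong continuity in the times -/

/-- Both outer factors depend on t. The increment is split at the fixed vector v = M S_t φ: the
isometry S_{-s} drops out of one term, and the other is strong continuity of S at v. -/
theorem continuous_leftProbOp (φ : L2Half) : Continuous fun t => leftProbOp t φ := by
  set M : L2Half →L[ℂ] L2Half := reverseFourier.adjoint ∘L negProj ∘L reverseFourier with hM
  have hP (t : ℝ) : leftProbOp t φ = freeEvolution (-t) (M (freeEvolution t φ)) := by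
    rw [← adjoint_freeEvolution]
    rfl
  refine continuous_iff_continuousAt.2 fun t => tendsto_iff_norm_sub_tendsto_zero.2 ?_
  set v : L2Half := M (freeEvolution t φ) with hv
  have h1 : Tendsto (fun s => ‖M (freeEvolution s φ) - v‖ +
      ‖freeEvolution (-s) v - freeEvolution (-t) v‖) (𝓝 t) (𝓝 (0 + 0)) := by
    refine Tendsto.add ?_ ?_ <;> refine tendsto_iff_norm_sub_tendsto_zero.1 ?_
    · exact (M.continuous.comp (continuous_freeEvolution φ)).tendsto t
    · exact ((continuous_freeEvolution v).comp continuous_neg).tendsto t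
  rw [add_zero] at h1
  refine squeeze_zero (fun _ => norm_nonneg _) (fun s => ?_) h1
  simp only [hP, ← hv]
  rw [← norm_freeEvolution (-s) (M (freeEvolution s φ) - v), map_sub]
  exact norm_sub_le_norm_sub_add_norm_sub _ _ _

theorem continuous_backflowOp (φ : L2Half) :
    Continuous fun t : ℝ × ℝ => backflowOp t.1 t.2 φ :=
  ((continuous_leftProbOp φ).comp continuous_snd).sub
    ((continuous_leftProbOp φ).comp continuous_fst)

/-! ### The kernel on integrable states, by damping -/

theorem integral_Iio_exp_mul {ε : ℝ} (hε : 0 < ε) (s : ℝ) :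
    ∫ x in Iio (0 : ℝ), Complex.exp ((ε + Complex.I * s) * x) = 1 / (ε + Complex.I * s) := by
  rw [setIntegral_congr_set Iio_ae_eq_Iic, integral_exp_mul_complex_Iic (by simpa using hε)]
  simp

theorem conj_fourierHalf_mul_fourierHalf (f g : ℝ → ℂ) (x : ℝ) :
    starRingEnd ℂ (fourierHalf f x) * fourierHalf g x =
      (1 / (2 * Real.pi) : ℝ) * ∫ z, Complex.exp ((Complex.I * (z.2 - z.1 : ℝ)) * x) *
        (starRingEnd ℂ (f z.1) * g z.2) ∂(μ₊.prod μ₊) := by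
  have h (z : ℝ × ℝ) : Complex.exp ((Complex.I * (z.2 - z.1 : ℝ)) * x) *
      (starRingEnd ℂ (f z.1) * g z.2) =
      starRingEnd ℂ (Complex.exp (((x * z.1 : ℝ) : ℂ) * Complex.I) * f z.1) *
        (Complex.exp (((x * z.2 : ℝ) : ℂ) * Complex.I) * g z.2) := by
    rw [map_mul, ← Complex.exp_conj, mul_mul_mul_comm, ← Complex.exp_add]
    congr 2
    simp only [map_mul, Complex.conj_ofReal, Complex.conj_I]
    push_cast
    ring
  simp_rw [h]
  rw [integral_prod_mul (μ := μ₊) (ν := μ₊)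
    (fun p => starRingEnd ℂ (Complex.exp (((x * p : ℝ) : ℂ) * Complex.I) * f p))
    (fun q => Complex.exp (((x * q : ℝ) : ℂ) * Complex.I) * g q), integral_conj, fourierHalf,
    fourierHalf, map_mul, Complex.conj_ofReal, mul_mul_mul_comm, ← Complex.ofReal_mul]
  congr 2
  rw [div_mul_div_comm, one_mul, Real.mul_self_sqrt (by positivity)]

/-- The factor e^{εx} makes the triple integrand absolutely integrable, so Fubini allows x to be
integrated first. -/
theorem integral_Iio_exp_mul_conj_fourierHalf {f g : ℝ → ℂ} (hf : Integrable f μ₊)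
    (hg : Integrable g μ₊) {ε : ℝ} (hε : 0 < ε) :
    ∫ x in Iio (0 : ℝ), Complex.exp (ε * x) *
        (starRingEnd ℂ (fourierHalf f x) * fourierHalf g x) =
      (1 / (2 * Real.pi) : ℝ) * ∫ z, starRingEnd ℂ (f z.1) * g z.2 *
        (1 / (ε + Complex.I * (z.2 - z.1 : ℝ))) ∂(μ₊.prod μ₊) := by
  have hfg : Integrable (fun z : ℝ × ℝ => starRingEnd ℂ (f z.1) * g z.2) (μ₊.prod μ₊) :=
    Integrable.mul_prod (f := fun p => starRingEnd ℂ (f p))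
      ((LinearIsometryEquiv.integrable_comp_iff (RCLike.conjLIE (K := ℂ))).2 hf) hg
  have hexp : Integrable (fun x : ℝ => Complex.exp (ε * x)) (volume.restrict (Iio (0 : ℝ))) := by
    have := integrableOn_exp_mul_complex_Iic (a := ε) (by simpa using hε) 0
    exact this.mono_set Iio_subset_Iic_self
  have hH : Integrable (Function.uncurry fun (x : ℝ) (z : ℝ × ℝ) =>
      Complex.exp ((ε + Complex.I * (z.2 - z.1 : ℝ)) * x) * (starRingEnd ℂ (f z.1) * g z.2))
      ((volume.restrict (Iio (0 : ℝ))).prod (μ₊.prod μ₊)) := by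
    have h1 := (hexp.mul_prod hfg).bdd_mul (c := 1)
      (f := fun w : ℝ × ℝ × ℝ => Complex.exp (((w.2.2 - w.2.1) * w.1 : ℝ) * Complex.I))
      (by fun_prop) (.of_forall fun w => (Complex.norm_exp_ofReal_mul_I _).le)
    refine h1.congr (.of_forall fun w => ?_)
    simp only [Function.uncurry]
    rw [← mul_assoc, ← Complex.exp_add]
    congr 2
    push_cast
    ring
  calc _ = (1 / (2 * Real.pi) : ℝ) * ∫ x in Iio (0 : ℝ), ∫ z,
        Complex.exp ((ε + Complex.I * (z.2 - z.1 : ℝ)) * x) *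
          (starRingEnd ℂ (f z.1) * g z.2) ∂(μ₊.prod μ₊) := by
        rw [← integral_const_mul]
        congr 1 with x
        rw [conj_fourierHalf_mul_fourierHalf, mul_left_comm, ← integral_const_mul]
        congr 2 with z
        rw [← mul_assoc, ← Complex.exp_add, ← add_mul]
    _ = _ := by
        rw [integral_integral_swap hH]
        congr 2 with z
        rw [integral_mul_const, integral_Iio_exp_mul hε, mul_comm]

/-- The kernel `(e^{it₂(p²-q²)} - e^{it₁(p²-q²)}) / (2πi(q-p))` of the backflow operator. -/
noncomputable def backflowKernel (t₁ t₂ p q : ℝ) : ℂ :=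
  (1 / (2 * Real.pi) : ℝ) * ((Complex.exp (((p ^ 2 - q ^ 2) * t₂ : ℝ) * Complex.I) -
    Complex.exp (((p ^ 2 - q ^ 2) * t₁ : ℝ) * Complex.I)) * (1 / (Complex.I * (q - p : ℝ))))

theorem measurable_backflowKernel (t₁ t₂ : ℝ) :
    Measurable fun z : ℝ × ℝ => backflowKernel t₁ t₂ z.1 z.2 := by
  unfold backflowKernel
  fun_prop

/-- On the position side e^{εx} ≤ 1 for x < 0, so the damping is removed by dominated convergence.
On the momentum side the limit stays outside the integral, where the kernel becomes singular. -/
theorem tendsto_inner_leftProbOp (t : ℝ) {f φ : L2Half} (hf : IntegrableOn f (Ioi 0))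
    (hφ : IntegrableOn φ (Ioi 0)) :
    Tendsto (fun ε : ℝ => (1 / (2 * Real.pi) : ℝ) * ∫ z, starRingEnd ℂ (f z.1) * φ z.2 *
        (Complex.exp (((z.1 ^ 2 - z.2 ^ 2) * t : ℝ) * Complex.I) *
          (1 / (ε + Complex.I * (z.2 - z.1 : ℝ)))) ∂(μ₊.prod μ₊))
      (𝓝[>] 0) (𝓝 ⟪f, leftProbOp t φ⟫_ℂ) := by
  have hint (g : L2Half) (hg : IntegrableOn g (Ioi 0)) :
      IntegrableOn (freeEvolution t g) (Ioi 0) := by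
    refine (hg.bdd_mul (c := 1)
      (f := fun k => Complex.exp (((-(k ^ 2 * t) : ℝ) : ℂ) * Complex.I)) (by fun_prop)
      (.of_forall fun k => (Complex.norm_exp_ofReal_mul_I _).le)).congr ?_
    exact (coeFn_freeEvolution t g).symm
  have hpos : ⟪f, leftProbOp t φ⟫_ℂ = ∫ x in Iio (0 : ℝ),
      starRingEnd ℂ (positionState t f x) * positionState t φ x := by
    rw [inner_leftProbOp_right, inner_eq_integral, ← integral_indicator measurableSet_Iio]
    refine integral_congr_ae ?_
    filter_upwards [coeFn_negProj (positionState t φ)] with x hx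
    rw [hx]
    by_cases h : x ∈ Iio (0 : ℝ)
    · rw [indicator_of_mem h, indicator_of_mem h]
    · rw [indicator_of_notMem h, indicator_of_notMem h, mul_zero]
  have hI : Integrable (fun x => starRingEnd ℂ (positionState t f x) * positionState t φ x)
      (volume.restrict (Iio (0 : ℝ))) := by
    refine Integrable.integrableOn ?_
    refine (L2.integrable_inner (𝕜 := ℂ) (positionState t f) (positionState t φ)).congr
      (.of_forall fun x => ?_)
    simp only [RCLike.inner_apply]
    rw [mul_comm]
  have hlim : Tendsto (fun ε : ℝ => ∫ x in Iio (0 : ℝ), Complex.exp (ε * x) *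
      (starRingEnd ℂ (positionState t f x) * positionState t φ x)) (𝓝[>] 0)
      (𝓝 ⟪f, leftProbOp t φ⟫_ℂ) := by
    rw [hpos]
    refine tendsto_integral_filter_of_dominated_convergence
      (fun x => ‖starRingEnd ℂ (positionState t f x) * positionState t φ x‖)
      (.of_forall fun ε => (by fun_prop : Continuous fun x : ℝ =>
        Complex.exp (ε * x)).aestronglyMeasurable.mul hI.1) ?_ hI.norm ?_
    · filter_upwards [self_mem_nhdsWithin] with ε (hε : 0 < ε)
      filter_upwards [ae_restrict_mem measurableSet_Iio] with x (hx : x < 0)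
      rw [norm_mul, ← Complex.ofReal_mul, Complex.norm_exp_ofReal]
      exact mul_le_of_le_one_left (norm_nonneg _)
        (Real.exp_le_one_iff.2 (mul_nonpos_of_nonneg_of_nonpos hε.le hx.le))
    · refine .of_forall fun x => Tendsto.mono_left ?_ nhdsWithin_le_nhds
      have : Continuous fun ε : ℝ => Complex.exp (ε * x) *
        (starRingEnd ℂ (positionState t f x) * positionState t φ x) := by fun_prop
      simpa using this.tendsto 0
  refine hlim.congr' ?_
  filter_upwards [self_mem_nhdsWithin] with ε (hε : 0 < ε)
  have hA := integral_Iio_exp_mul_conj_fourierHalf (hint f hf) (hint φ hφ) hε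
  have hB : ∫ x in Iio (0 : ℝ), Complex.exp (ε * x) *
      (starRingEnd ℂ (positionState t f x) * positionState t φ x) =
      ∫ x in Iio (0 : ℝ), Complex.exp (ε * x) * (starRingEnd ℂ (fourierHalf (freeEvolution t f) x) *
        fourierHalf (freeEvolution t φ) x) := by
    refine integral_congr_ae (ae_restrict_of_ae ?_)
    filter_upwards [coeFn_reverseFourier (hint f hf), coeFn_reverseFourier (hint φ hφ)] with x h1 h2
    rw [← h1, ← h2]
    rfl
  rw [hB, hA]
  congr 1
  refine integral_congr_ae ?_
  have h1 := Measure.quasiMeasurePreserving_fst (μ := μ₊) (ν := μ₊) |>.ae_eq_comp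
    (coeFn_freeEvolution t f)
  have h2 := Measure.quasiMeasurePreserving_snd (μ := μ₊) (ν := μ₊) |>.ae_eq_comp
    (coeFn_freeEvolution t φ)
  filter_upwards [h1, h2] with z hz1 hz2
  simp only [Function.comp_apply] at hz1 hz2
  rw [hz1, hz2, map_mul, ← Complex.exp_conj, mul_mul_mul_comm, ← Complex.exp_add, mul_comm
    (Complex.exp _), mul_assoc]
  congr 3
  simp only [map_mul, Complex.conj_ofReal, Complex.conj_I]
  push_cast
  ring

/-- After subtraction the limit may go inside: |1/(ε + is)| ≤ 1/|s|, so the integrand at ε = 0,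
integrable by `hk`, dominates all the others. -/
theorem inner_backflowOp_of_integrable (t₁ t₂ : ℝ) {f φ : L2Half} (hf : IntegrableOn f (Ioi 0))
    (hφ : IntegrableOn φ (Ioi 0))
    (hk : Integrable (fun z : ℝ × ℝ => starRingEnd ℂ (f z.1) * φ z.2 *
      backflowKernel t₁ t₂ z.1 z.2) (μ₊.prod μ₊)) :
    ⟪f, backflowOp t₁ t₂ φ⟫_ℂ = ∫ z, starRingEnd ℂ (f z.1) * φ z.2 *
      backflowKernel t₁ t₂ z.1 z.2 ∂(μ₊.prod μ₊) := by
  have hsub : ⟪f, backflowOp t₁ t₂ φ⟫_ℂ =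
      ⟪f, leftProbOp t₂ φ⟫_ℂ - ⟪f, leftProbOp t₁ φ⟫_ℂ := by
    rw [backflowOp, sub_apply, inner_sub_right]
  have hfφ : Integrable (fun z : ℝ × ℝ => starRingEnd ℂ (f z.1) * φ z.2) (μ₊.prod μ₊) :=
    Integrable.mul_prod (f := fun p => starRingEnd ℂ (f p))
      ((LinearIsometryEquiv.integrable_comp_iff (RCLike.conjLIE (K := ℂ))).2 hf) hφ
  set D : ℝ × ℝ → ℂ := fun z => Complex.exp (((z.1 ^ 2 - z.2 ^ 2) * t₂ : ℝ) * Complex.I) -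
    Complex.exp (((z.1 ^ 2 - z.2 ^ 2) * t₁ : ℝ) * Complex.I) with hD
  set R : ℝ → ℝ × ℝ → ℂ := fun ε z => 1 / (ε + Complex.I * (z.2 - z.1 : ℝ)) with hR
  have hDm : Measurable D := by fun_prop
  have hRm (ε : ℝ) : Measurable (R ε) := by fun_prop
  have hnorm (ε : ℝ) (z : ℝ × ℝ) : |z.2 - z.1| ≤ ‖(ε : ℂ) + Complex.I * (z.2 - z.1 : ℝ)‖ := by
    have := Complex.abs_im_le_norm ((ε : ℂ) + Complex.I * (z.2 - z.1 : ℝ))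
    simpa using this
  have hRint (t : ℝ) {ε : ℝ} (hε : 0 < ε) :
      Integrable (fun z : ℝ × ℝ => starRingEnd ℂ (f z.1) * φ z.2 *
        (Complex.exp (((z.1 ^ 2 - z.2 ^ 2) * t : ℝ) * Complex.I) * R ε z)) (μ₊.prod μ₊) := by
    refine hfφ.mul_bdd (c := 1 / ε) ?_ (.of_forall fun z => ?_)
    · exact ((by fun_prop : Measurable fun z : ℝ × ℝ =>
        Complex.exp (((z.1 ^ 2 - z.2 ^ 2) * t : ℝ) * Complex.I)).mul (hRm ε)).aestronglyMeasurable
    · rw [norm_mul, Complex.norm_exp_ofReal_mul_I, one_mul, norm_div, norm_one]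
      refine one_div_le_one_div_of_le hε ?_
      have := Complex.re_le_norm ((ε : ℂ) + Complex.I * (z.2 - z.1 : ℝ))
      simpa using this
  have hlim : Tendsto (fun ε : ℝ => (1 / (2 * Real.pi) : ℝ) *
      ∫ z, starRingEnd ℂ (f z.1) * φ z.2 * (D z * R ε z) ∂(μ₊.prod μ₊)) (𝓝[>] 0)
      (𝓝 ⟪f, backflowOp t₁ t₂ φ⟫_ℂ) := by
    rw [hsub]
    refine ((tendsto_inner_leftProbOp t₂ hf hφ).sub (tendsto_inner_leftProbOp t₁ hf hφ)).congr' ?_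
    filter_upwards [self_mem_nhdsWithin] with ε (hε : 0 < ε)
    rw [← mul_sub, ← integral_sub (hRint t₂ hε) (hRint t₁ hε)]
    simp only [hD, sub_mul, mul_sub, hR]
  have hfac (z : ℝ × ℝ) : ((1 / (2 * Real.pi) : ℝ) : ℂ) *
      (starRingEnd ℂ (f z.1) * φ z.2 * (D z * R 0 z)) =
      starRingEnd ℂ (f z.1) * φ z.2 * backflowKernel t₁ t₂ z.1 z.2 := by
    simp only [hD, hR, backflowKernel, Complex.ofReal_zero, zero_add]
    ring
  have hpi : ((1 / (2 * Real.pi) : ℝ) : ℂ) ≠ 0 := by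
    exact_mod_cast (by positivity : (1 / (2 * Real.pi) : ℝ) ≠ 0)
  have hk0 : Integrable (fun z : ℝ × ℝ => starRingEnd ℂ (f z.1) * φ z.2 * (D z * R 0 z))
      (μ₊.prod μ₊) := by
    rw [← integrable_const_mul_iff (IsUnit.mk0 _ hpi)]
    simpa only [hfac] using hk
  refine tendsto_nhds_unique hlim ?_
  simp_rw [← hfac]
  rw [integral_const_mul]
  refine Tendsto.const_mul _ ?_
  -- On the diagonal `R 0 z` is `1 / 0 = 0` and does not bound `R ε z`; there the vanishing of `D`
  -- gives the bound and the limit.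
  have hD0 (z : ℝ × ℝ) (hz : z.2 - z.1 = 0) : D z = 0 := by
    rw [sub_eq_zero] at hz
    simp [hD, hz]
  refine tendsto_integral_filter_of_dominated_convergence _ (.of_forall fun ε =>
    hfφ.1.mul (hDm.mul (hRm ε)).aestronglyMeasurable) (.of_forall fun ε => .of_forall fun z => ?_)
    hk0.norm (.of_forall fun z => ?_)
  · rw [norm_mul, norm_mul _ (D z * R 0 z)]
    refine mul_le_mul_of_nonneg_left ?_ (norm_nonneg _)
    by_cases hz : z.2 - z.1 = 0
    · simp [hD0 z hz]
    · rw [norm_mul, norm_mul]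
      refine mul_le_mul_of_nonneg_left ?_ (norm_nonneg _)
      simp only [hR, Complex.ofReal_zero, zero_add]
      rw [norm_div, norm_div, norm_mul Complex.I, Complex.norm_I, one_mul, Complex.norm_real]
      exact div_le_div_of_nonneg_left (by simp) (abs_pos.2 hz) (hnorm ε z)
  · by_cases hz : z.2 - z.1 = 0
    · simp [hD0 z hz]
    · refine Tendsto.const_mul _ (Tendsto.const_mul _ ?_)
      refine Tendsto.mono_left ?_ nhdsWithin_le_nhds
      have hc : ContinuousAt (fun ε : ℝ => R ε z) 0 := by
        simp only [hR]
        refine ContinuousAt.div (by fun_prop) (by fun_prop) ?_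
        simpa [Complex.ext_iff] using hz
      exact hc

/-! ### Decay of the kernel and extension to all of L² -/

theorem norm_exp_sub_exp_le (a b : ℝ) :
    ‖Complex.exp (a * Complex.I) - Complex.exp (b * Complex.I)‖ ≤ |a - b| := by
  have h : Complex.exp (a * Complex.I) - Complex.exp (b * Complex.I) =
      Complex.exp (b * Complex.I) * (Complex.exp (Complex.I * (a - b : ℝ)) - 1) := by
    rw [mul_sub, ← Complex.exp_add, mul_one]
    congr 2
    push_cast
    ring
  rw [h, norm_mul, Complex.norm_exp_ofReal_mul_I, one_mul]
  exact Real.norm_exp_I_mul_ofReal_sub_one_le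

/-- On bounded sets of `p` the backflow kernel decays like `1 / q`. -/
theorem exists_norm_backflowKernel_le (t₁ t₂ M : ℝ) (hM : 0 ≤ M) :
    ∃ c : ℝ, ∀ p q : ℝ, 0 < p → p ≤ M → 0 < q →
      ‖backflowKernel t₁ t₂ p q‖ ≤ c * (1 + q)⁻¹ := by
  -- For q ≤ 2M + 1 the chord bound cancels q - p, leaving p + q ≤ 3M + 1 and 1 + q ≤ 2M + 2. For
  -- larger q, |q - p| ≥ (1 + q)/2 and the phase difference is at most 2, which gives 4.
  refine ⟨|t₂ - t₁| * (3 * M + 1) * (2 * M + 2) + 4, fun p q hp hpM hq => ?_⟩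
  rw [← div_eq_mul_inv, le_div_iff₀ (by linarith), backflowKernel, norm_mul, norm_mul, norm_div,
    norm_mul Complex.I, Complex.norm_I, Complex.norm_real, Complex.norm_real, one_mul, norm_one]
  set δ : ℝ := ‖Complex.exp (((p ^ 2 - q ^ 2) * t₂ : ℝ) * Complex.I) -
    Complex.exp (((p ^ 2 - q ^ 2) * t₁ : ℝ) * Complex.I)‖ with hδ
  have hδ0 : 0 ≤ δ := norm_nonneg _
  have hδ1 : δ ≤ |t₂ - t₁| * (p + q) * |q - p| := by
    refine (norm_exp_sub_exp_le _ _).trans (le_of_eq ?_)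
    rw [← mul_sub, abs_mul, sq_sub_sq, abs_mul, abs_of_pos (by linarith : 0 < p + q),
      abs_sub_comm p q]
    ring
  have hδ2 : δ ≤ 2 := by
    refine (norm_sub_le _ _).trans (le_of_eq ?_)
    rw [Complex.norm_exp_ofReal_mul_I, Complex.norm_exp_ofReal_mul_I]
    norm_num
  have hpi : ‖(1 / (2 * Real.pi) : ℝ)‖ ≤ 1 := by
    rw [Real.norm_of_nonneg (by positivity)]
    exact (div_le_one (by positivity)).2 (by linarith [Real.pi_gt_three])
  have hA : 0 ≤ |t₂ - t₁| * (3 * M + 1) * (2 * M + 2) := by positivity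
  have hkey : δ * (1 / ‖q - p‖) * (1 + q) ≤ |t₂ - t₁| * (3 * M + 1) * (2 * M + 2) + 4 := by
    rw [Real.norm_eq_abs]
    by_cases hq2 : q ≤ 2 * M + 1
    · have h1 : δ * (1 / |q - p|) ≤ |t₂ - t₁| * (3 * M + 1) := by
        by_cases h0 : |q - p| = 0
        · rw [h0]
          simp only [div_zero, mul_zero]
          positivity
        · have h0' : 0 < |q - p| := lt_of_le_of_ne (abs_nonneg _) (Ne.symm h0)
          rw [mul_one_div, div_le_iff₀ h0']
          refine hδ1.trans (mul_le_mul_of_nonneg_right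
            (mul_le_mul_of_nonneg_left ?_ (abs_nonneg _)) (abs_nonneg _))
          linarith
      calc _ ≤ |t₂ - t₁| * (3 * M + 1) * (2 * M + 2) := by
            refine mul_le_mul h1 ?_ (by linarith) (by positivity)
            linarith
        _ ≤ _ := by linarith
    · push Not at hq2
      have h0 : (1 + q) / 2 ≤ |q - p| := by
        rw [abs_of_pos (by linarith)]
        linarith
      have h0' : 0 < |q - p| := lt_of_lt_of_le (by linarith) h0
      rw [mul_one_div, div_mul_eq_mul_div]
      refine ((div_le_iff₀ h0').2 ?_ : _ ≤ (4 : ℝ)).trans (by linarith)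
      nlinarith
  rw [mul_assoc]
  refine (mul_le_mul_of_nonneg_right hpi (by positivity)).trans ?_
  rwa [one_mul]

/-- This envelope of the kernel is square integrable, so it pairs with any state in L². -/
theorem memLp_inv_one_add : MemLp (fun q : ℝ => (1 + q)⁻¹) 2 μ₊ := by
  have hm : Measurable fun q : ℝ => (1 + q)⁻¹ := by fun_prop
  rw [memLp_two_iff_integrable_sq hm.aestronglyMeasurable]
  have h := integrable_inv_one_add_sq.integrableOn (s := Ioi (0 : ℝ))
  refine Integrable.mono h (hm.pow_const 2).aestronglyMeasurable ?_
  filter_upwards [ae_restrict_mem measurableSet_Ioi] with q (hq : 0 < q)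
  rw [Real.norm_of_nonneg (by positivity), Real.norm_of_nonneg (by positivity), inv_pow]
  gcongr
  nlinarith

theorem integrable_inv_one_add_mul_norm (φ : L2Half) :
    Integrable (fun q : ℝ => (1 + q)⁻¹ * ‖φ q‖) μ₊ :=
  memLp_inv_one_add.integrable_mul (Lp.memLp φ).norm

theorem integrable_backflowKernel_mul (t₁ t₂ : ℝ) {p : ℝ} (hp : 0 < p) (φ : L2Half) :
    Integrable (fun q => backflowKernel t₁ t₂ p q * φ q) μ₊ := by
  obtain ⟨c, hc⟩ := exists_norm_backflowKernel_le t₁ t₂ p hp.le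
  refine ((integrable_inv_one_add_mul_norm φ).const_mul c).mono' ?_ ?_
  · exact ((measurable_backflowKernel t₁ t₂).comp
      measurable_prodMk_left).aestronglyMeasurable.mul (Lp.aestronglyMeasurable φ)
  · filter_upwards [ae_restrict_mem measurableSet_Ioi] with q (hq : 0 < q)
    rw [norm_mul, ← mul_assoc]
    gcongr
    exact hc p q hp le_rfl hq

/-- Truncation to momenta at most `N`. -/
noncomputable def truncation (N : ℕ) : L2Half →L[ℂ] L2Half :=
  mulOp _ ((Iic (N : ℝ)).indicator 1) (measurable_one.indicator measurableSet_Iic)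
    (fun x => by by_cases h : x ∈ Iic (N : ℝ) <;> simp [h])

theorem coeFn_truncation (N : ℕ) (φ : L2Half) :
    truncation N φ =ᵐ[μ₊] (Iic (N : ℝ)).indicator φ := by
  filter_upwards [coeFn_mulOp μ₊ ((Iic (N : ℝ)).indicator 1)
    (measurable_one.indicator measurableSet_Iic)
    (fun x => by by_cases h : x ∈ Iic (N : ℝ) <;> simp [h]) φ] with x hx
  rw [truncation, hx]
  by_cases h : x ∈ Iic (N : ℝ)
  · rw [indicator_of_mem h, indicator_of_mem h, Pi.one_apply, one_mul]
  · rw [indicator_of_notMem h, indicator_of_notMem h, zero_mul]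

theorem tendsto_truncation (φ : L2Half) :
    Tendsto (fun N => truncation N φ) atTop (𝓝 φ) := by
  have h1 : mulOp μ₊ (fun _ => 1) measurable_const (fun _ => by simp) φ = φ := by
    refine Lp.ext ?_
    filter_upwards [coeFn_mulOp μ₊ (fun _ => 1) measurable_const (fun _ => by simp) φ] with x hx
    rw [hx, one_mul]
  have := tendsto_mulOp (μ := μ₊) (l := atTop) (m := fun N : ℕ => (Iic (N : ℝ)).indicator 1)
    (m' := fun _ => 1) (fun N => measurable_one.indicator measurableSet_Iic)
    (fun N x => by by_cases h : x ∈ Iic (N : ℝ) <;> simp [h]) measurable_const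
    (fun _ => by simp) (fun x => ?_) φ
  · rwa [h1] at this
  · obtain ⟨N, hN⟩ := exists_nat_ge x
    refine tendsto_const_nhds.congr' ?_
    filter_upwards [eventually_ge_atTop N] with n hn
    have hx : x ∈ Iic (n : ℝ) := hN.trans (by exact_mod_cast hn)
    rw [indicator_of_mem hx, Pi.one_apply]

theorem integrable_truncation (N : ℕ) (φ : L2Half) : IntegrableOn (truncation N φ) (Ioi 0) := by
  have hfin : IsFiniteMeasure (μ₊.restrict (Iic (N : ℝ))) := by
    rw [Measure.restrict_restrict measurableSet_Iic, Iic_inter_Ioi]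
    infer_instance
  refine Integrable.congr ?_ (coeFn_truncation N φ).symm
  refine (integrable_indicator_iff measurableSet_Iic).2 ?_
  exact ((Lp.memLp φ).restrict (Iic (N : ℝ))).integrable (by norm_num)

theorem ae_prod_mem_Ioi : ∀ᵐ z ∂(μ₊.prod μ₊), 0 < z.1 ∧ 0 < z.2 := by
  rw [Measure.prod_restrict]
  exact ae_restrict_mem (measurableSet_Ioi.prod measurableSet_Ioi)

/-- The majorant is a product of functions of p and of q, and it also dominates every truncation of
φ. -/
theorem exists_bound_indicator_mul_backflowKernel (t₁ t₂ : ℝ) (φ : L2Half) {M : ℝ} (hM : 0 ≤ M)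
    {s : Set ℝ} (hs : MeasurableSet s) (hsM : s ⊆ Ioc 0 M) :
    ∃ b : ℝ × ℝ → ℝ, Integrable b (μ₊.prod μ₊) ∧ ∀ᵐ z ∂(μ₊.prod μ₊),
      ‖s.indicator (1 : ℝ → ℂ) z.1 * φ z.2 * backflowKernel t₁ t₂ z.1 z.2‖ ≤ b z := by
  obtain ⟨c, hc⟩ := exists_norm_backflowKernel_le t₁ t₂ M hM
  have hsfin : μ₊ s ≠ ∞ := ((Measure.restrict_apply_le _ _).trans
    (measure_mono hsM)).trans_lt measure_Ioc_lt_top |>.ne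
  refine ⟨fun z => s.indicator (1 : ℝ → ℝ) z.1 * (c * ((1 + z.2)⁻¹ * ‖φ z.2‖)), ?_, ?_⟩
  · exact ((integrable_indicator_iff hs).2 (integrableOn_const hsfin)).mul_prod
      ((integrable_inv_one_add_mul_norm φ).const_mul c)
  · filter_upwards [ae_prod_mem_Ioi] with z hz
    by_cases h : z.1 ∈ s
    · rw [indicator_of_mem h, indicator_of_mem h, Pi.one_apply, Pi.one_apply, one_mul, one_mul,
        norm_mul, mul_comm, ← mul_assoc]
      exact mul_le_mul_of_nonneg_right (hc _ _ hz.1 (hsM h).2 hz.2) (norm_nonneg _)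
    · rw [indicator_of_notMem h, indicator_of_notMem h]
      simp

theorem aestronglyMeasurable_indicator_mul_backflowKernel (t₁ t₂ : ℝ) (φ : L2Half)
    {s : Set ℝ} (hs : MeasurableSet s) :
    AEStronglyMeasurable (fun z : ℝ × ℝ => s.indicator (1 : ℝ → ℂ) z.1 * φ z.2 *
      backflowKernel t₁ t₂ z.1 z.2) (μ₊.prod μ₊) :=
  ((((measurable_one.indicator hs).comp measurable_fst).mul
    ((Lp.stronglyMeasurable φ).measurable.comp measurable_snd)).mul
      (measurable_backflowKernel t₁ t₂)).aestronglyMeasurable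

theorem integrable_indicator_mul_backflowKernel (t₁ t₂ : ℝ) (φ : L2Half) {M : ℝ} (hM : 0 ≤ M)
    {s : Set ℝ} (hs : MeasurableSet s) (hsM : s ⊆ Ioc 0 M) :
    Integrable (fun z : ℝ × ℝ => s.indicator (1 : ℝ → ℂ) z.1 * φ z.2 *
      backflowKernel t₁ t₂ z.1 z.2) (μ₊.prod μ₊) := by
  obtain ⟨b, hb, hle⟩ := exists_bound_indicator_mul_backflowKernel t₁ t₂ φ hM hs hsM
  exact hb.mono' (aestronglyMeasurable_indicator_mul_backflowKernel t₁ t₂ φ hs) hle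

/-- Test against the indicator of s. For truncated φ, which is integrable, the kernel formula is
known; the limit N → ∞ uses boundedness of the operator on one side and dominated convergence on the
other. -/
theorem setIntegral_backflowOp (t₁ t₂ : ℝ) (φ : L2Half) {M : ℝ} (hM : 0 ≤ M) {s : Set ℝ}
    (hs : MeasurableSet s) (hsM : s ⊆ Ioc 0 M) :
    ∫ p in s, backflowOp t₁ t₂ φ p =
      ∫ z, s.indicator (1 : ℝ → ℂ) z.1 * φ z.2 * backflowKernel t₁ t₂ z.1 z.2 ∂(μ₊.prod μ₊) := by
  have hsfin : μ₊ s ≠ ∞ := ((Measure.restrict_apply_le _ _).trans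
    (measure_mono hsM)).trans_lt measure_Ioc_lt_top |>.ne
  set f : L2Half := indicatorConstLp 2 hs hsfin (1 : ℂ) with hf
  have hfx : f =ᵐ[μ₊] s.indicator (1 : ℝ → ℂ) := indicatorConstLp_coeFn
  have hfint : IntegrableOn f (Ioi 0) :=
    ((integrable_indicator_iff hs).2 (integrableOn_const hsfin)).congr hfx.symm
  have hinner (g : L2Half) : ⟪f, g⟫_ℂ = ∫ p in s, g p := by
    rw [hf, L2.inner_indicatorConstLp_one, Measure.restrict_restrict hs,
      inter_eq_left.2 (hsM.trans Ioc_subset_Ioi_self)]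
  have hcongr (N : ℕ) : (fun z : ℝ × ℝ => s.indicator (1 : ℝ → ℂ) z.1 *
      (Iic (N : ℝ)).indicator φ z.2 * backflowKernel t₁ t₂ z.1 z.2) =ᵐ[μ₊.prod μ₊]
      fun z => starRingEnd ℂ (f z.1) * truncation N φ z.2 * backflowKernel t₁ t₂ z.1 z.2 := by
    filter_upwards [Measure.quasiMeasurePreserving_fst (μ := μ₊) (ν := μ₊) |>.ae_eq_comp hfx,
      Measure.quasiMeasurePreserving_snd (μ := μ₊) (ν := μ₊) |>.ae_eq_comp
        (coeFn_truncation N φ)] with z h1 h2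
    simp only [Function.comp_apply] at h1 h2
    rw [h1, h2]
    by_cases h : z.1 ∈ s <;> simp [h]
  obtain ⟨b, hb, hle⟩ := exists_bound_indicator_mul_backflowKernel t₁ t₂ φ hM hs hsM
  have hleN (N : ℕ) : ∀ᵐ z ∂(μ₊.prod μ₊), ‖s.indicator (1 : ℝ → ℂ) z.1 *
      (Iic (N : ℝ)).indicator φ z.2 * backflowKernel t₁ t₂ z.1 z.2‖ ≤ b z := by
    filter_upwards [hle] with z hz
    refine le_trans ?_ hz
    rw [norm_mul, norm_mul, norm_mul, norm_mul]
    gcongr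
    exact norm_indicator_le_norm_self _ _
  have hmeasN (N : ℕ) : AEStronglyMeasurable (fun z : ℝ × ℝ => s.indicator (1 : ℝ → ℂ) z.1 *
      (Iic (N : ℝ)).indicator φ z.2 * backflowKernel t₁ t₂ z.1 z.2) (μ₊.prod μ₊) :=
    ((((measurable_one.indicator hs).comp measurable_fst).mul
      (((Lp.stronglyMeasurable φ).measurable.indicator measurableSet_Iic).comp
        measurable_snd)).mul (measurable_backflowKernel t₁ t₂)).aestronglyMeasurable
  have hN (N : ℕ) : ⟪f, backflowOp t₁ t₂ (truncation N φ)⟫_ℂ =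
      ∫ z, s.indicator (1 : ℝ → ℂ) z.1 * (Iic (N : ℝ)).indicator φ z.2 *
        backflowKernel t₁ t₂ z.1 z.2 ∂(μ₊.prod μ₊) := by
    rw [inner_backflowOp_of_integrable t₁ t₂ hfint (integrable_truncation N φ)
      ((hb.mono' (hmeasN N) (hleN N)).congr (hcongr N))]
    exact (integral_congr_ae (hcongr N)).symm
  have hl1 : Tendsto (fun N => ⟪f, backflowOp t₁ t₂ (truncation N φ)⟫_ℂ) atTop
      (𝓝 ⟪f, backflowOp t₁ t₂ φ⟫_ℂ) :=
    tendsto_const_nhds.inner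
      (((backflowOp t₁ t₂).continuous.tendsto φ).comp (tendsto_truncation φ))
  rw [← hinner]
  refine tendsto_nhds_unique hl1 ?_
  simp_rw [hN]
  refine tendsto_integral_of_dominated_convergence b hmeasN hb hleN (.of_forall fun z => ?_)
  obtain ⟨N, hN⟩ := exists_nat_ge z.2
  refine tendsto_const_nhds.congr' ?_
  filter_upwards [eventually_ge_atTop N] with n hn
  have hx : z.2 ∈ Iic (n : ℝ) := hN.trans (by exact_mod_cast hn)
  rw [indicator_of_mem hx]

/-- The backflow operator is the integral operator with kernel `backflowKernel`. -/
theorem coeFn_backflowOp (t₁ t₂ : ℝ) (φ : L2Half) :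
    backflowOp t₁ t₂ φ =ᵐ[μ₊]
      fun p => ∫ q in Ioi (0 : ℝ), backflowKernel t₁ t₂ p q * φ q := by
  set K : ℝ → ℂ := fun p => ∫ q in Ioi (0 : ℝ), backflowKernel t₁ t₂ p q * φ q with hK
  have hfub (s : Set ℝ) (p : ℝ) : ∫ q in Ioi (0 : ℝ), s.indicator (1 : ℝ → ℂ) p * φ q *
      backflowKernel t₁ t₂ p q = s.indicator K p := by
    by_cases h : p ∈ s
    · simp only [indicator_of_mem h, Pi.one_apply, one_mul, hK]
      simp_rw [mul_comm]
    · simp [indicator_of_notMem h]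
  have hU : Ioi (0 : ℝ) = ⋃ n : ℕ, Ioc 0 (n : ℝ) := by
    ext x
    simp only [mem_Ioi, mem_iUnion, mem_Ioc]
    exact ⟨fun h => (exists_nat_ge x).imp fun n hn => ⟨h, hn⟩, fun ⟨n, h⟩ => h.1⟩
  -- On each bounded interval both functions are integrable and have equal integrals over all
  -- measurable subsets.
  have hloc (n : ℕ) : backflowOp t₁ t₂ φ =ᵐ[volume.restrict (Ioc 0 (n : ℝ))] K := by
    have hsub : Ioc 0 (n : ℝ) ⊆ Ioi 0 := fun x hx => hx.1
    refine Integrable.ae_eq_of_forall_setIntegral_eq _ _ ?_ ?_ fun s hs _ => ?_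
    · exact ((Lp.memLp (backflowOp t₁ t₂ φ)).mono_measure
        (Measure.restrict_mono hsub le_rfl)).integrable (by norm_num)
    · have := (integrable_indicator_mul_backflowKernel t₁ t₂ φ n.cast_nonneg
        measurableSet_Ioc subset_rfl).integral_prod_left
      simp only [hfub] at this
      rw [integrable_indicator_iff measurableSet_Ioc, IntegrableOn,
        Measure.restrict_restrict measurableSet_Ioc, inter_eq_left.2 hsub] at this
      exact this
    · have hm := hs.inter (measurableSet_Ioc (a := (0 : ℝ)) (b := n))
      rw [Measure.restrict_restrict hs, setIntegral_backflowOp t₁ t₂ φ n.cast_nonneg hm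
        inter_subset_right, integral_prod _ (integrable_indicator_mul_backflowKernel t₁ t₂ φ
        n.cast_nonneg hm inter_subset_right)]
      simp only [hfub]
      rw [integral_indicator hm, Measure.restrict_restrict hm,
        inter_eq_left.2 (inter_subset_right.trans hsub)]
  have h := (ae_restrict_iUnion_iff _ _).2 hloc
  rwa [← hU] at h

/-! ### Weighted changes of variables and the energy representation -/

/-- `g` is a change of variables of the half-line with Jacobian `|a|²`. -/
def IsChangeOfVariables (g : ℝ → ℝ) (a : ℝ → ℂ) : Prop :=
  ∀ F : ℝ → ℝ≥0∞, ∫⁻ x in Ioi (0 : ℝ), ‖a x‖ₑ ^ (2 : ℝ) * F (g x) = ∫⁻ x in Ioi (0 : ℝ), F x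

/-- Applied to the indicator of a null set, the formula makes the weighted indicator of the preimage
integrate to zero; the weight does not vanish, so the preimage is null. -/
theorem IsChangeOfVariables.quasiMeasurePreserving {g : ℝ → ℝ} {a : ℝ → ℂ}
    (h : IsChangeOfVariables g a) (hg : Measurable g) (ha : Measurable a)
    (ha0 : ∀ x, 0 < x → a x ≠ 0) : Measure.QuasiMeasurePreserving g μ₊ μ₊ := by
  refine ⟨hg, Measure.AbsolutelyContinuous.mk fun s hs h0 => ?_⟩
  rw [Measure.map_apply hg hs]
  have h1 := h (s.indicator 1)
  rw [lintegral_indicator_one hs, h0, lintegral_eq_zero_iff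
    (f := fun x => ‖a x‖ₑ ^ (2 : ℝ) * s.indicator 1 (g x))
    ((ha.enorm.pow_const _).mul ((measurable_one.indicator hs).comp hg))] at h1
  have h2 : ∀ᵐ x ∂μ₊, x ∉ g ⁻¹' s := by
    filter_upwards [h1, ae_restrict_mem measurableSet_Ioi] with x hx (hx0 : 0 < x) hmem
    have : a x ≠ 0 := ha0 x hx0
    simp only [Pi.zero_apply, mul_eq_zero] at hx
    rw [indicator_of_mem (show g x ∈ s from hmem)] at hx
    simp [this] at hx
  exact measure_eq_zero_iff_ae_notMem.2 h2

theorem IsChangeOfVariables.eLpNorm_eq {g : ℝ → ℝ} {a : ℝ → ℂ} (h : IsChangeOfVariables g a)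
    (f : ℝ → ℂ) : eLpNorm (fun x => a x * f (g x)) 2 μ₊ = eLpNorm f 2 μ₊ := by
  rw [eLpNorm_eq_lintegral_rpow_enorm_toReal (by norm_num) (by norm_num),
    eLpNorm_eq_lintegral_rpow_enorm_toReal (by norm_num) (by norm_num)]
  simp only [ENNReal.toReal_ofNat]
  rw [← h fun x => ‖f x‖ₑ ^ (2 : ℝ)]
  simp_rw [enorm_mul, ENNReal.mul_rpow_of_nonneg _ _ zero_le_two]

/-- The isometry `f ↦ a · (f ∘ g)` of `L²(ℝ⁺)` given by a change of variables. -/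
noncomputable def weightedPullback (g : ℝ → ℝ) (a : ℝ → ℂ) (h : IsChangeOfVariables g a)
    (ha : Measurable a) (hg : Measure.QuasiMeasurePreserving g μ₊ μ₊) : L2Half →L[ℂ] L2Half :=
  ofAction
    { toFun := fun f x => a x * f (g x)
      map_add' := fun f f' => by ext x; simp [mul_add]
      map_smul' := fun c f => by ext x; simp [mul_left_comm] }
    (fun f f' hff' => by
      filter_upwards [hg.ae_eq_comp hff'] with x hx
      exact congrArg (fun z => a x * z) hx)
    (fun f hf => ha.aestronglyMeasurable.mul (hf.comp_quasiMeasurePreserving hg))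
    (fun f _ => (h.eLpNorm_eq f).le)

theorem coeFn_weightedPullback {g : ℝ → ℝ} {a : ℝ → ℂ} (h : IsChangeOfVariables g a)
    (ha : Measurable a) (hg : Measure.QuasiMeasurePreserving g μ₊ μ₊) (f : L2Half) :
    weightedPullback g a h ha hg f =ᵐ[μ₊] fun x => a x * f (g x) :=
  coeFn_ofAction _ _ _ _ f

theorem norm_weightedPullback {g : ℝ → ℝ} {a : ℝ → ℂ} (h : IsChangeOfVariables g a)
    (ha : Measurable a) (hg : Measure.QuasiMeasurePreserving g μ₊ μ₊) (f : L2Half) :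
    ‖weightedPullback g a h ha hg f‖ = ‖f‖ := by
  rw [Lp.norm_def, Lp.norm_def, eLpNorm_congr_ae (coeFn_weightedPullback h ha hg f), h.eLpNorm_eq]

theorem hasDerivAt_const_mul_sq (T p : ℝ) : HasDerivAt (fun p => T * p ^ 2) (2 * T * p) p := by
  have := (hasDerivAt_pow 2 p).const_mul T
  refine this.congr_deriv ?_
  push_cast
  ring

theorem injOn_const_mul_sq {T : ℝ} (hT : 0 < T) : InjOn (fun p => T * p ^ 2) (Ioi 0) := by
  intro p (hp : 0 < p) q (hq : 0 < q) h
  have h' : p ^ 2 = q ^ 2 := mul_left_cancel₀ hT.ne' h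
  exact (pow_left_inj₀ hp.le hq.le two_ne_zero).1 h'

theorem image_const_mul_sq {T : ℝ} (hT : 0 < T) :
    (fun p => T * p ^ 2) '' Ioi (0 : ℝ) = Ioi 0 := by
  ext u
  constructor
  · rintro ⟨p, hp : 0 < p, rfl⟩
    exact mul_pos hT (pow_pos hp 2)
  · intro (hu : 0 < u)
    refine ⟨√(u / T), Real.sqrt_pos.2 (div_pos hu hT), ?_⟩
    simp only [Real.sq_sqrt (div_pos hu hT).le]
    field_simp

/-- The weight `e^{imp²} (2Tp)^{1/2}` attached to the substitution `u = T p²`. -/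
noncomputable def energyWeight (m T p : ℝ) : ℂ :=
  Complex.exp ((m * p ^ 2 : ℝ) * Complex.I) * (√(2 * T * p) : ℝ)

theorem measurable_energyWeight (m T : ℝ) : Measurable (energyWeight m T) := by
  unfold energyWeight
  fun_prop

theorem norm_energyWeight (m T p : ℝ) : ‖energyWeight m T p‖ = √(2 * T * p) := by
  rw [energyWeight, norm_mul, Complex.norm_exp_ofReal_mul_I, one_mul, Complex.norm_real,
    Real.norm_of_nonneg (Real.sqrt_nonneg _)]

theorem energyWeight_ne_zero (m : ℝ) {T p : ℝ} (hT : 0 < T) (hp : 0 < p) :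
    energyWeight m T p ≠ 0 := by
  rw [← norm_pos_iff, norm_energyWeight]
  positivity

theorem isChangeOfVariables_energyWeight (m : ℝ) {T : ℝ} (hT : 0 < T) :
    IsChangeOfVariables (fun p => T * p ^ 2) (energyWeight m T) := by
  intro F
  have h := lintegral_image_eq_lintegral_abs_deriv_mul measurableSet_Ioi
    (fun p _ => (hasDerivAt_const_mul_sq T p).hasDerivWithinAt) (injOn_const_mul_sq hT) F
  rw [image_const_mul_sq hT] at h
  rw [h]
  refine setLIntegral_congr_fun measurableSet_Ioi fun p (hp : 0 < p) => ?_
  have h0 : 0 ≤ 2 * T * p := by positivity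
  simp only []
  rw [← ofReal_norm, norm_energyWeight, ENNReal.ofReal_rpow_of_nonneg (Real.sqrt_nonneg _)
    zero_le_two, Real.rpow_two, Real.sq_sqrt h0, abs_of_nonneg h0]

theorem sqrt_mul_sq_div {T p : ℝ} (hT : 0 < T) (hp : 0 < p) : √(T * p ^ 2 / T) = p := by
  rw [mul_div_cancel_left₀ _ hT.ne', Real.sqrt_sq hp.le]

theorem mul_sqrt_div_sq {T u : ℝ} (hT : 0 < T) (hu : 0 < u) : T * √(u / T) ^ 2 = u := by
  rw [Real.sq_sqrt (div_pos hu hT).le, mul_div_cancel₀ _ hT.ne']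

/-- The forward formula is applied to the integrand itself and the two weights cancel. No
measurability arises, since the formula holds for every F. -/
theorem isChangeOfVariables_inv_energyWeight (m : ℝ) {T : ℝ} (hT : 0 < T) :
    IsChangeOfVariables (fun u => √(u / T)) (fun u => (energyWeight m T √(u / T))⁻¹) := by
  intro F
  rw [← isChangeOfVariables_energyWeight m hT]
  refine setLIntegral_congr_fun measurableSet_Ioi fun p (hp : 0 < p) => ?_
  simp only [sqrt_mul_sq_div hT hp]
  rw [← mul_assoc, ← ENNReal.mul_rpow_of_nonneg _ _ zero_le_two, ← enorm_mul,
    mul_inv_cancel₀ (energyWeight_ne_zero m hT hp)]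
  simp

theorem quasiMeasurePreserving_const_mul_sq {T : ℝ} (hT : 0 < T) :
    Measure.QuasiMeasurePreserving (fun p => T * p ^ 2) μ₊ μ₊ :=
  (isChangeOfVariables_energyWeight 0 hT).quasiMeasurePreserving (by fun_prop)
    (measurable_energyWeight 0 T) fun _ hp => energyWeight_ne_zero 0 hT hp

theorem measurable_inv_energyWeight (m T : ℝ) :
    Measurable fun u => (energyWeight m T √(u / T))⁻¹ :=
  ((measurable_energyWeight m T).comp (by fun_prop)).inv

theorem quasiMeasurePreserving_sqrt_div {T : ℝ} (hT : 0 < T) :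
    Measure.QuasiMeasurePreserving (fun u => √(u / T)) μ₊ μ₊ :=
  (isChangeOfVariables_inv_energyWeight 0 hT).quasiMeasurePreserving (by fun_prop)
    (measurable_inv_energyWeight 0 T) fun _ hu =>
      inv_ne_zero (energyWeight_ne_zero 0 hT (Real.sqrt_pos.2 (div_pos hu hT)))

/-- The isometry `f ↦ e^{imp²} (2Tp)^{1/2} f(T p²)` of `L²(ℝ⁺)`. -/
noncomputable def fromEnergy (m : ℝ) {T : ℝ} (hT : 0 < T) : L2Half →L[ℂ] L2Half :=
  weightedPullback (fun p => T * p ^ 2) (energyWeight m T) (isChangeOfVariables_energyWeight m hT)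
    (measurable_energyWeight m T) (quasiMeasurePreserving_const_mul_sq hT)

/-- The inverse of `fromEnergy`. -/
noncomputable def toEnergy (m : ℝ) {T : ℝ} (hT : 0 < T) : L2Half →L[ℂ] L2Half :=
  weightedPullback (fun u => √(u / T)) (fun u => (energyWeight m T √(u / T))⁻¹)
    (isChangeOfVariables_inv_energyWeight m hT) (measurable_inv_energyWeight m T)
    (quasiMeasurePreserving_sqrt_div hT)

theorem coeFn_fromEnergy (m : ℝ) {T : ℝ} (hT : 0 < T) (f : L2Half) :
    fromEnergy m hT f =ᵐ[μ₊] fun p => energyWeight m T p * f (T * p ^ 2) :=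
  coeFn_weightedPullback _ _ _ f

theorem coeFn_toEnergy (m : ℝ) {T : ℝ} (hT : 0 < T) (f : L2Half) :
    toEnergy m hT f =ᵐ[μ₊] fun u => (energyWeight m T √(u / T))⁻¹ * f √(u / T) :=
  coeFn_weightedPullback (isChangeOfVariables_inv_energyWeight m hT) _ _ f

theorem toEnergy_fromEnergy (m : ℝ) {T : ℝ} (hT : 0 < T) (f : L2Half) :
    toEnergy m hT (fromEnergy m hT f) = f := by
  refine Lp.ext ?_
  filter_upwards [coeFn_toEnergy m hT (fromEnergy m hT f),
    (quasiMeasurePreserving_sqrt_div hT).ae_eq_comp (coeFn_fromEnergy m hT f),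
    ae_restrict_mem measurableSet_Ioi] with u h1 h2 (hu : 0 < u)
  simp only [Function.comp_apply] at h2
  rw [h1, h2, mul_sqrt_div_sq hT hu, inv_mul_cancel_left₀
    (energyWeight_ne_zero m hT (Real.sqrt_pos.2 (div_pos hu hT)))]

theorem fromEnergy_toEnergy (m : ℝ) {T : ℝ} (hT : 0 < T) (f : L2Half) :
    fromEnergy m hT (toEnergy m hT f) = f := by
  refine Lp.ext ?_
  filter_upwards [coeFn_fromEnergy m hT (toEnergy m hT f),
    (quasiMeasurePreserving_const_mul_sq hT).ae_eq_comp (coeFn_toEnergy m hT f),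
    ae_restrict_mem measurableSet_Ioi] with p h1 h2 (hp : 0 < p)
  simp only [Function.comp_apply] at h2
  rw [h1, h2, sqrt_mul_sq_div hT hp, mul_inv_cancel_left₀ (energyWeight_ne_zero m hT hp)]

theorem norm_toEnergy (m : ℝ) {T : ℝ} (hT : 0 < T) (f : L2Half) : ‖toEnergy m hT f‖ = ‖f‖ :=
  norm_weightedPullback (isChangeOfVariables_inv_energyWeight m hT) _ _ f

/-- The unitary of `L²(ℝ⁺)` that passes to the scaled energy variable `u = T p²` after free
evolution for time `m`. -/
noncomputable def energyUnitary (m : ℝ) {T : ℝ} (hT : 0 < T) : L2Half ≃ₗᵢ[ℂ] L2Half where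
  toLinearEquiv := LinearEquiv.ofLinearMap (toEnergy m hT).toLinearMap
    (fromEnergy m hT).toLinearMap (LinearMap.ext (toEnergy_fromEnergy m hT))
    (LinearMap.ext (fromEnergy_toEnergy m hT))
  norm_map' := norm_toEnergy m hT

/-! ### The backflow kernel in the energy variable -/

/-- With p = a² and q = b² the fourth root of the energy ratio is a/b. The bracket a/b + b/a = (a² +
b²)/(ab) cancels the factor p + q of p² - q². -/
theorem kernelC_mul_sq_mul_sq {T : ℝ} (hT : 0 < T) {p q : ℝ} (hp : 0 < p) (hq : 0 < q) :
    2 * T * q * kernelC (T * p ^ 2) (T * q ^ 2) =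
      (√(2 * T * p))⁻¹ * ((1 / (2 * Real.pi)) *
        (2 * Real.sin (T * (p ^ 2 - q ^ 2)) * (1 / (q - p)))) * √(2 * T * q) := by
  obtain ⟨a, ha, rfl⟩ : ∃ a : ℝ, 0 < a ∧ p = a ^ 2 :=
    ⟨√p, Real.sqrt_pos.2 hp, (Real.sq_sqrt hp.le).symm⟩
  obtain ⟨b, hb, rfl⟩ : ∃ b : ℝ, 0 < b ∧ q = b ^ 2 :=
    ⟨√q, Real.sqrt_pos.2 hq, (Real.sq_sqrt hq.le).symm⟩
  have hr : (T * (a ^ 2) ^ 2 / (T * (b ^ 2) ^ 2)) ^ (1 / 4 : ℝ) = a / b := by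
    rw [mul_div_mul_left _ _ hT.ne', ← pow_mul, ← pow_mul, ← div_pow, one_div]
    exact Real.pow_rpow_inv_natCast (n := 4) (by positivity) (by norm_num)
  rw [kernelC, Real.rpow_neg (by positivity), hr, Real.sqrt_mul (by positivity),
    Real.sqrt_mul (by positivity) (b ^ 2), Real.sqrt_sq ha.le, Real.sqrt_sq hb.le, ← mul_sub]
  have hT2 : √(2 * T) ≠ 0 := (Real.sqrt_pos.2 (by positivity)).ne'
  by_cases hab : a ^ 2 - b ^ 2 = 0
  · have : b ^ 2 - a ^ 2 = 0 := by linarith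
    rw [sub_eq_zero] at hab
    simp [hab]
  · have hba : b ^ 2 - a ^ 2 ≠ 0 := fun h => hab (by linarith)
    have hsum : a ^ 2 + b ^ 2 ≠ 0 := by positivity
    have hden : (a ^ 2) ^ 2 - (b ^ 2) ^ 2 = (a ^ 2 + b ^ 2) * (a ^ 2 - b ^ 2) := by ring
    have hneg : b ^ 2 - a ^ 2 = -(a ^ 2 - b ^ 2) := by ring
    have hpi := Real.pi_ne_zero
    generalize Real.sin (T * ((a ^ 2) ^ 2 - (b ^ 2) ^ 2)) = s
    rw [hden, hneg]
    field_simp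

theorem inv_energyWeight_mul_backflowKernel_mul (m : ℝ) {T : ℝ} (hT : 0 < T) {p q : ℝ}
    (hp : 0 < p) (hq : 0 < q) :
    (energyWeight m T p)⁻¹ * backflowKernel (m - T) (m + T) p q * energyWeight m T q =
      ((2 * T * q * kernelC (T * p ^ 2) (T * q ^ 2) : ℝ) : ℂ) := by
  have hexp : Complex.exp (-((m * p ^ 2 : ℝ) * Complex.I)) *
      (Complex.exp (((p ^ 2 - q ^ 2) * (m + T) : ℝ) * Complex.I) -
        Complex.exp (((p ^ 2 - q ^ 2) * (m - T) : ℝ) * Complex.I)) *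
      Complex.exp ((m * q ^ 2 : ℝ) * Complex.I) =
      2 * Complex.I * Complex.sin ((T * (p ^ 2 - q ^ 2) : ℝ)) := by
    rw [Complex.sin, mul_sub, sub_mul, ← Complex.exp_add, ← Complex.exp_add, ← Complex.exp_add,
      ← Complex.exp_add]
    have h1 : -((m * p ^ 2 : ℝ) * Complex.I) + ((p ^ 2 - q ^ 2) * (m + T) : ℝ) * Complex.I +
        (m * q ^ 2 : ℝ) * Complex.I = (T * (p ^ 2 - q ^ 2) : ℝ) * Complex.I := by
      push_cast; ring
    have h2 : -((m * p ^ 2 : ℝ) * Complex.I) + ((p ^ 2 - q ^ 2) * (m - T) : ℝ) * Complex.I +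
        (m * q ^ 2 : ℝ) * Complex.I = -(T * (p ^ 2 - q ^ 2) : ℝ) * Complex.I := by
      push_cast; ring
    rw [h1, h2]
    -- The definition of `Complex.sin` carries a factor `I`; `I * I = -1` fixes the sign.
    linear_combination (-(Complex.exp (-(T * (p ^ 2 - q ^ 2) : ℝ) * Complex.I) -
      Complex.exp ((T * (p ^ 2 - q ^ 2) : ℝ) * Complex.I))) * Complex.I_mul_I
  rw [kernelC_mul_sq_mul_sq hT hp hq, backflowKernel, energyWeight, energyWeight, mul_inv,
    ← Complex.exp_neg]
  have hI : (1 : ℂ) / (Complex.I * (q - p : ℝ)) * Complex.I = 1 / (q - p : ℝ) := by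
    rw [one_div, mul_inv, mul_comm, ← mul_assoc, mul_inv_cancel₀ Complex.I_ne_zero, one_mul,
      one_div]
  push_cast at hexp hI ⊢
  linear_combination ((√(2 * T * p) : ℝ) : ℂ)⁻¹ * (1 / (2 * Real.pi)) *
    (1 / (Complex.I * (q - p))) * (√(2 * T * q) : ℝ) * hexp +
    ((√(2 * T * p) : ℝ) : ℂ)⁻¹ * (1 / (2 * Real.pi)) * 2 *
      Complex.sin (T * (p ^ 2 - q ^ 2)) * (√(2 * T * q) : ℝ) * hI

/-- `B_{⟨t₁,t₂⟩}` transported to the scaled energy variable. -/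
noncomputable def energyBackflowOp (m : ℝ) {T : ℝ} (hT : 0 < T) : L2Half →L[ℂ] L2Half :=
  (energyUnitary m hT).toContinuousLinearEquiv.toContinuousLinearMap ∘L
    backflowOp (m - T) (m + T) ∘L
      (energyUnitary m hT).symm.toContinuousLinearEquiv.toContinuousLinearMap

/-- The weights of the unitary turn `backflowKernel` into `kernelC` times the Jacobian 2Tq, which
the substitution v = Tq² absorbs, both for integrability and for the value. -/
theorem hasKernel_energyBackflowOp (m : ℝ) {T : ℝ} (hT : 0 < T) :
    HasKernel (energyBackflowOp m hT) kernelC := by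
  intro φ
  set ψ : L2Half := fromEnergy m hT φ with hψ
  have hC : energyBackflowOp m hT φ =
    toEnergy m hT (backflowOp (m - T) (m + T) ψ) := rfl
  filter_upwards [coeFn_toEnergy m hT (backflowOp (m - T) (m + T) ψ),
    (quasiMeasurePreserving_sqrt_div hT).ae_eq_comp (coeFn_backflowOp (m - T) (m + T) ψ),
    ae_restrict_mem measurableSet_Ioi] with u h1 h2 (hu : 0 < u)
  simp only [Function.comp_apply] at h2
  set p : ℝ := √(u / T) with hp
  have hp0 : 0 < p := Real.sqrt_pos.2 (div_pos hu hT)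
  have hup : T * p ^ 2 = u := mul_sqrt_div_sq hT hu
  have hae : (fun q => (energyWeight m T p)⁻¹ * (backflowKernel (m - T) (m + T) p q * ψ q))
      =ᵐ[μ₊] fun q => |2 * T * q| • ((kernelC u (T * q ^ 2) : ℂ) * φ (T * q ^ 2)) := by
    filter_upwards [coeFn_fromEnergy m hT φ, ae_restrict_mem measurableSet_Ioi] with
      q hq (hq0 : 0 < q)
    rw [hψ, hq, abs_of_pos (by positivity), Complex.real_smul, ← mul_assoc, ← mul_assoc,
      ← mul_assoc, inv_energyWeight_mul_backflowKernel_mul m hT hp0 hq0, hup, Complex.ofReal_mul]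
  have himg := image_const_mul_sq hT
  have hder := fun q (_ : q ∈ Ioi (0 : ℝ)) =>
    (hasDerivAt_const_mul_sq T q).hasDerivWithinAt (s := Ioi 0)
  constructor
  · have h := (integrableOn_image_iff_integrableOn_abs_deriv_smul measurableSet_Ioi hder
      (injOn_const_mul_sq hT) fun v => (kernelC u v : ℂ) * φ v).2
      (((integrable_backflowKernel_mul _ _ hp0 ψ).const_mul _).congr hae)
    rwa [himg] at h
  · rw [hC, h1, h2, ← integral_const_mul, integral_congr_ae hae,
      ← integral_image_eq_integral_abs_deriv_smul measurableSet_Ioi hder (injOn_const_mul_sq hT)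
        (fun v => (kernelC u v : ℂ) * φ v), himg]

theorem HasKernel.unique {C C' : L2Half →L[ℂ] L2Half} {K : ℝ → ℝ → ℝ} (h : HasKernel C K)
    (h' : HasKernel C' K) : C = C' := by
  refine ContinuousLinearMap.ext fun φ => Lp.ext ?_
  filter_upwards [h φ, h' φ] with p h1 h2
  rw [h1.2, h2.2]

/-- The operator for the interval (-1, 1), that is m = 0 and T = 1, serves as C; by uniqueness it
equals the one built from the midpoint and half-length of (t₁, t₂). -/
theorem unitarilyEquivalent_backflowOp {t₁ t₂ : ℝ} (h : t₁ < t₂) :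
    UnitarilyEquivalent (backflowOp t₁ t₂) (energyBackflowOp 0 one_pos) := by
  have hT : 0 < (t₂ - t₁) / 2 := by linarith
  rw [(hasKernel_energyBackflowOp 0 one_pos).unique
    (hasKernel_energyBackflowOp ((t₁ + t₂) / 2) hT)]
  refine ⟨energyUnitary ((t₁ + t₂) / 2) hT, fun φ => ?_⟩
  have h1 : (t₁ + t₂) / 2 - (t₂ - t₁) / 2 = t₁ := by ring
  have h2 : (t₁ + t₂) / 2 + (t₂ - t₁) / 2 = t₂ := by ring
  rw [energyBackflowOp, h1, h2]
  rfl

theorem UnitarilyEquivalent.norm_eq {A A' : L2Half →L[ℂ] L2Half}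
    (h : UnitarilyEquivalent A A') : ‖A‖ = ‖A'‖ := by
  obtain ⟨U, hU⟩ := h
  refine le_antisymm ?_ ?_
  · refine A.opNorm_le_bound (norm_nonneg _) fun φ => ?_
    have := A'.le_opNorm (U φ)
    rwa [← hU, U.symm_apply_apply, U.norm_map, U.norm_map] at this
  · refine A'.opNorm_le_bound (norm_nonneg _) fun φ => ?_
    have := A.le_opNorm (U.symm φ)
    rwa [← U.norm_map, hU, U.symm.norm_map] at this

/-! ### Boosted states and the lower bound for the norm -/

theorem measure_Ioc_nat (n : ℕ) : μ₊ (Ioc (n : ℝ) (n + 1)) = 1 := by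
  have hsub : Ioc (n : ℝ) (n + 1) ⊆ Ioi 0 := fun x hx => n.cast_nonneg.trans_lt hx.1
  rw [Measure.restrict_apply measurableSet_Ioc, inter_eq_left.2 hsub, Real.volume_Ioc]
  simp

/-- The normalised state with constant momentum density on `(n, n + 1]`. -/
noncomputable def momentumBox (n : ℕ) : L2Half :=
  indicatorConstLp 2 (measurableSet_Ioc (a := (n : ℝ)) (b := n + 1))
    (measure_Ioc_nat n ▸ ENNReal.one_ne_top) (1 : ℂ)

theorem coeFn_momentumBox (n : ℕ) :
    momentumBox n =ᵐ[μ₊] (Ioc (n : ℝ) (n + 1)).indicator fun _ => 1 :=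
  indicatorConstLp_coeFn

theorem norm_momentumBox (n : ℕ) : ‖momentumBox n‖ = 1 := by
  rw [momentumBox, norm_indicatorConstLp (by norm_num) (by norm_num), measureReal_def,
    measure_Ioc_nat]
  simp

/-- The position-space wavefunction at time `t` of `momentumBox n`. -/
noncomputable def boxWave (t : ℝ) (n : ℕ) (x : ℝ) : ℂ :=
  ((1 / √(2 * Real.pi) : ℝ) : ℂ) *
    ∫ k in (n : ℝ)..(n + 1), Complex.exp ((x * k - k ^ 2 * t : ℝ) * Complex.I)

theorem coeFn_positionState_momentumBox (t : ℝ) (n : ℕ) :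
    positionState t (momentumBox n) =ᵐ[volume] boxWave t n := by
  have hS : freeEvolution t (momentumBox n) =ᵐ[μ₊] (Ioc (n : ℝ) (n + 1)).indicator fun k =>
      Complex.exp (((-(k ^ 2 * t) : ℝ) : ℂ) * Complex.I) := by
    filter_upwards [coeFn_freeEvolution t (momentumBox n), coeFn_momentumBox n] with k h1 h2
    rw [h1, h2]
    by_cases h : k ∈ Ioc (n : ℝ) (n + 1)
    · rw [indicator_of_mem h, indicator_of_mem h, mul_one]
    · rw [indicator_of_notMem h, indicator_of_notMem h, mul_zero]
  have hint : IntegrableOn (freeEvolution t (momentumBox n)) (Ioi 0) := by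
    refine Integrable.congr ?_ hS.symm
    refine (integrable_indicator_iff measurableSet_Ioc).2 ?_
    refine Integrable.mono_measure (ν := volume.restrict (Ioc (n : ℝ) (n + 1))) ?_
      (Measure.restrict_mono_measure Measure.restrict_le_self _)
    exact ((by fun_prop : Continuous fun k : ℝ => Complex.exp (((-(k ^ 2 * t) : ℝ) : ℂ) *
      Complex.I)).integrableOn_Icc).mono_set Ioc_subset_Icc_self
  filter_upwards [coeFn_reverseFourier hint] with x hx
  refine hx.trans ?_
  rw [fourierHalf, boxWave, intervalIntegral.integral_of_le (by linarith)]
  congr 1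
  have hsub : Ioc (n : ℝ) (n + 1) ⊆ Ioi 0 := fun x hx => n.cast_nonneg.trans_lt hx.1
  rw [← inter_eq_left.2 hsub, ← Measure.restrict_restrict measurableSet_Ioc,
    ← integral_indicator measurableSet_Ioc]
  refine integral_congr_ae ?_
  filter_upwards [hS] with k hk
  rw [hk]
  by_cases h : k ∈ Ioc (n : ℝ) (n + 1)
  · rw [indicator_of_mem h, indicator_of_mem h, ← Complex.exp_add]
    congr 1
    push_cast
    ring
  · rw [indicator_of_notMem h, indicator_of_notMem h, mul_zero]

/-- A momentum boost by `n` translates the probability density at time `t` by `2nt`. -/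
theorem norm_boxWave (t : ℝ) (n : ℕ) (x : ℝ) : ‖boxWave t n x‖ = ‖boxWave t 0 (x - 2 * n * t)‖ := by
  have h := intervalIntegral.integral_comp_add_right (a := 0) (b := 1)
    (fun k : ℝ => Complex.exp ((x * k - k ^ 2 * t : ℝ) * Complex.I)) (n : ℝ)
  rw [zero_add, add_comm (1 : ℝ)] at h
  -- Expanding (k + n)²t, the cross term 2nkt shifts x and the remaining terms form a phase
  -- independent of k.
  have hexp (k : ℝ) : Complex.exp ((x * (k + n) - (k + n) ^ 2 * t : ℝ) * Complex.I) =
      Complex.exp ((x * n - n ^ 2 * t : ℝ) * Complex.I) *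
        Complex.exp (((x - 2 * n * t) * k - k ^ 2 * t : ℝ) * Complex.I) := by
    rw [← Complex.exp_add]
    congr 1
    push_cast
    ring
  simp_rw [hexp] at h
  rw [boxWave, boxWave, ← h, intervalIntegral.integral_const_mul, mul_left_comm, norm_mul,
    Complex.norm_exp_ofReal_mul_I, one_mul, Nat.cast_zero, zero_add]

/-- Translating x by 2nt moves the whole dependence on n into the domain of integration of a fixed
density. -/
theorem leftProb_momentumBox (t : ℝ) (n : ℕ) :
    leftProb (momentumBox n) t =
      ∫ x, (Iio (-(2 * n * t))).indicator (fun x => ‖boxWave t 0 x‖ ^ 2) x := by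
  have h1 : leftProb (momentumBox n) t = ∫ x in Iio (0 : ℝ), ‖boxWave t n x‖ ^ 2 := by
    refine integral_congr_ae (ae_restrict_of_ae ?_)
    filter_upwards [coeFn_positionState_momentumBox t n] with x hx
    rw [← hx]
    rfl
  rw [h1, ← integral_indicator measurableSet_Iio, ← integral_add_right_eq_self _ (2 * n * t)]
  congr 1 with x
  simp only [indicator, mem_Iio, norm_boxWave t n, add_sub_cancel_right, lt_neg_iff_add_neg]

theorem integrable_sq_norm_boxWave (t : ℝ) : Integrable fun x => ‖boxWave t 0 x‖ ^ 2 := by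
  refine ((memLp_two_iff_integrable_sq_norm (Lp.aestronglyMeasurable _)).1
    (Lp.memLp (positionState t (momentumBox 0)))).congr ?_
  filter_upwards [coeFn_positionState_momentumBox t 0] with x hx
  rw [hx]

theorem integral_sq_norm_boxWave (t : ℝ) : ∫ x, ‖boxWave t 0 x‖ ^ 2 = 1 := by
  have h1 : ⟪positionState t (momentumBox 0), positionState t (momentumBox 0)⟫_ℂ =
      ((∫ x, ‖boxWave t 0 x‖ ^ 2 : ℝ) : ℂ) := by
    rw [inner_eq_integral, ← integral_complex_ofReal]
    refine integral_congr_ae ?_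
    filter_upwards [coeFn_positionState_momentumBox t 0] with x hx
    rw [hx, Complex.conj_mul']
    push_cast
    rfl
  rw [inner_self_eq_norm_sq_to_K, norm_positionState, norm_momentumBox] at h1
  have h2 := congrArg Complex.re h1
  simpa using h2.symm

/-- The half-lines x < -2nt recede to -∞, so the integrable density loses all its mass on them. -/
theorem tendsto_leftProb_momentumBox_of_pos {t : ℝ} (ht : 0 < t) :
    Tendsto (fun n => leftProb (momentumBox n) t) atTop (𝓝 0) := by
  simp_rw [leftProb_momentumBox]
  have hI := integrable_sq_norm_boxWave t
  rw [← integral_zero ℝ ℝ (μ := volume)]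
  refine tendsto_integral_of_dominated_convergence (fun x => ‖‖boxWave t 0 x‖ ^ 2‖)
    (fun n => hI.1.indicator measurableSet_Iio) hI.norm
    (fun n => .of_forall fun x => norm_indicator_le_norm_self _ _) (.of_forall fun x => ?_)
  obtain ⟨N, hN⟩ := exists_nat_ge (-x / (2 * t))
  refine tendsto_const_nhds.congr' ?_
  filter_upwards [eventually_ge_atTop N] with n hn
  have h1 : -x / (2 * t) ≤ n := hN.trans (by exact_mod_cast hn)
  rw [div_le_iff₀ (by positivity)] at h1
  rw [indicator_of_notMem]
  rw [mem_Iio, not_lt]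
  linarith

/-- For t < 0 the half-lines x < -2nt exhaust the line, so the limit is the total mass. -/
theorem tendsto_leftProb_momentumBox_of_neg {t : ℝ} (ht : t < 0) :
    Tendsto (fun n => leftProb (momentumBox n) t) atTop (𝓝 1) := by
  simp_rw [leftProb_momentumBox]
  have hI := integrable_sq_norm_boxWave t
  rw [← integral_sq_norm_boxWave t]
  refine tendsto_integral_of_dominated_convergence (fun x => ‖‖boxWave t 0 x‖ ^ 2‖)
    (fun n => hI.1.indicator measurableSet_Iio) hI.norm
    (fun n => .of_forall fun x => norm_indicator_le_norm_self _ _) (.of_forall fun x => ?_)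
  obtain ⟨N, hN⟩ := exists_nat_gt (x / (2 * -t))
  refine tendsto_const_nhds.congr' ?_
  filter_upwards [eventually_ge_atTop N] with n hn
  have h1 : x / (2 * -t) < n := hN.trans_le (by exact_mod_cast hn)
  rw [div_lt_iff₀ (by linarith)] at h1
  rw [indicator_of_mem]
  rw [mem_Iio]
  linarith

theorem one_le_norm_backflowOp_of_neg_of_pos {t₁ t₂ : ℝ} (h₁ : t₁ < 0) (h₂ : 0 < t₂) :
    1 ≤ ‖backflowOp t₁ t₂‖ := by
  have hlim := ((tendsto_leftProb_momentumBox_of_pos h₂).sub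
    (tendsto_leftProb_momentumBox_of_neg h₁)).abs
  rw [zero_sub, abs_neg, abs_one] at hlim
  refine le_of_tendsto' hlim fun n => ?_
  have h := norm_inner_le_norm (𝕜 := ℂ) (momentumBox n) (backflowOp t₁ t₂ (momentumBox n))
  rw [inner_backflowOp, Complex.norm_real, norm_momentumBox, one_mul] at h
  refine h.trans (((backflowOp t₁ t₂).le_opNorm _).trans (le_of_eq ?_))
  rw [norm_momentumBox, mul_one]

/-- The boost argument needs times of opposite sign; passing through C transfers its bound from (-1,
1) to any interval. -/
theorem norm_backflowOp {t₁ t₂ : ℝ} (h : t₁ < t₂) : ‖backflowOp t₁ t₂‖ = 1 := by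
  refine le_antisymm (norm_backflowOp_le t₁ t₂) ?_
  rw [(unitarilyEquivalent_backflowOp h).norm_eq,
    ← (unitarilyEquivalent_backflowOp (by norm_num : (-1 : ℝ) < 1)).norm_eq]
  exact one_le_norm_backflowOp_of_neg_of_pos (by norm_num) one_pos

end Backflow

theorem mainTheorem5 :
    (∀ t₁ t₂ : ℝ, t₁ < t₂ →
      IsSelfAdjoint (Backflow.backflowOp t₁ t₂) ∧ ‖Backflow.backflowOp t₁ t₂‖ = 1) ∧
    (∃ C : Backflow.L2Half →L[ℂ] Backflow.L2Half,
      Backflow.HasKernel C Backflow.kernelC ∧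
      ∀ t₁ t₂ : ℝ, t₁ < t₂ →
        Backflow.UnitarilyEquivalent (Backflow.backflowOp t₁ t₂) C) ∧
    (∀ φ : Backflow.L2Half,
      ContinuousOn (fun t : ℝ × ℝ => Backflow.backflowOp t.1 t.2 φ)
        {t : ℝ × ℝ | t.1 < t.2}) :=
  ⟨fun _ _ h => ⟨Backflow.isSelfAdjoint_backflowOp _ _, Backflow.norm_backflowOp h⟩,
    ⟨_, Backflow.hasKernel_energyBackflowOp 0 one_pos,
      fun _ _ h => Backflow.unitarilyEquivalent_backflowOp h⟩,
    fun φ => (Backflow.continuous_backflowOp φ).continuousOn⟩
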